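/- Let $c>0$, $\alpha\in\mathbb R$, $C_\lambda,C_\mu>0$, and let $\beta:\mathbb Z\to(0,\infty)$ satisfy $\sup_{n}\beta(n)<\infty$. Let $\mathbf B$ be the Banach space of real sequences $p=(p_n)_{n\in\mathbb Z}$ with $\|p\|_\alpha=\sum_{n\in\mathbb Z}|p_n|\,e^{cn^2/2+\alpha|n|}<\infty$. For real functions $p_n$ ($n\in\mathbb Z$), $L$, $M$ on $[0,\infty)$ put $\lambda_n(t)=\beta(n)e^{-c(n-L(t))}$ and $\mu_n(t)=\beta(n-1)e^{c(n-M(t))}$, and consider the infinite system $$\frac{dp_n}{dt}=\lambda_{n-1}p_{n-1}-(\lambda_n+\mu_n)p_n+\mu_{n+1}p_{n+1}\quad(n\in\mathbb Z),\qquad \frac{dL}{dt}=-\sum_{n\in\mathbb Z}p_n\lambda_n+C_\lambda,\qquad \frac{dM}{dt}=\sum_{n\in\mathbb Z}p_n\mu_n-C_\mu .$$ **Theorem 1.** Let $p(0)\in\mathbf B$ be a probability measure on $\mathbb Z$ and let $L(0),M(0)\in\mathbb R$ be arbitrary. Then the system with these initial conditions has a solution $(p,L,M)$ on $[0,\infty)$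 such that $t\mapsto p(t)$ is a continuous $\mathbf B$-valued function and $L,M\in C^2([0,\infty))$, and the solution is unique in this class. Moreover, for every $t\ge 0$, $p(t)$ is a probability measure on $\mathbb Z$, that is, $p_n(t)\ge0$ and $\sum_n p_n(t)=1$. If $C_\lambda=C_\mu$, the same existence, uniqueness and probability statements hold for the system written in the variables $s=\frac{L+M}2$, $d=\frac{L-M}2$: $$p_n'=e^{cd}\Big[\beta(n-1)e^{c(-n+1+s)}p_{n-1}-\big(\beta(n)e^{c(-n+s)}+\beta(n-1)e^{c(n-s)}\big)p_n+\beta(n)e^{c(n+1-s)}p_{n+1}\Big],\quad n\in\mathbb Z,$$ $$s'=-\tfrac12e^{cd}\Big(\sum_np_n\beta(n)e^{c(-n+s)}-\sum_np_n\beta(n-1)e^{c(n-s)}\Big),\qquad d'=-\tfrac12e^{cd}\Big(\sum_np_n\beta(n)e^{c(-n+s)}+\sum_np_n\beta(n-1)e^{c(n-s)}\Big)+C_\lambda .$$ -/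

import Mathlib

open Set Filter Topology

noncomputable section

namespace NonlinearWalk

/-- The weight `exp (c n² / 2 + α |n|)` on `ℤ`. -/
def weight (c α : ℝ) (n : ℤ) : ℝ :=
  Real.exp (c * (n : ℝ) ^ 2 / 2 + α * |(n : ℝ)|)

/-- Membership in the weighted `ℓ¹` space `𝐁` of two-sided real sequences. -/
def MemB (c α : ℝ) (p : ℤ → ℝ) : Prop :=
  Summable fun n : ℤ => |p n| * weight c α n

/-- The norm of `𝐁` (meaningful on sequences that satisfy `MemB c α`). -/
def normB (c α : ℝ) (p : ℤ → ℝ) : ℝ :=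
  ∑' n : ℤ, |p n| * weight c α n

/-- `p` is a probability measure on `ℤ`. -/
def IsProb (p : ℤ → ℝ) : Prop :=
  (∀ n, 0 ≤ p n) ∧ HasSum p 1

/-- The intensity of the jump `n → n + 1`. -/
def rateUp (β : ℤ → ℝ) (c L : ℝ) (n : ℤ) : ℝ :=
  β n * Real.exp (-c * ((n : ℝ) - L))

/-- The intensity of the jump `n → n - 1`. -/
def rateDown (β : ℤ → ℝ) (c M : ℝ) (n : ℤ) : ℝ :=
  β (n - 1) * Real.exp (c * ((n : ℝ) - M))

/-- The function space for solutions on `[0, ∞)`: `p` is a continuous `𝐁`-valued function and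
`L`, `M` are twice continuously differentiable. Only values at times `t ≥ 0` matter. -/
structure InClass (c α : ℝ) (p : ℝ → ℤ → ℝ) (L M : ℝ → ℝ) : Prop where
  mem : ∀ t, 0 ≤ t → MemB c α (p t)
  cont : ∀ t, 0 ≤ t → Tendsto (fun u => normB c α (p u - p t)) (𝓝[Ici 0] t) (𝓝 0)
  contDiff_L : ContDiffOn ℝ 2 L (Ici 0)
  contDiff_M : ContDiffOn ℝ 2 M (Ici 0)

/-- The infinite system for `(p, L, M)` on `[0, ∞)` (one-sided derivatives at `t = 0`). On
`InClass c α` all the series converge absolutely. -/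
structure SystemLM (β : ℤ → ℝ) (c Cl Cm : ℝ) (p : ℝ → ℤ → ℝ) (L M : ℝ → ℝ) : Prop where
  eq_p : ∀ t, 0 ≤ t → ∀ n : ℤ, HasDerivWithinAt (fun u => p u n)
    (rateUp β c (L t) (n - 1) * p t (n - 1)
      - (rateUp β c (L t) n + rateDown β c (M t) n) * p t n
      + rateDown β c (M t) (n + 1) * p t (n + 1)) (Ici 0) t
  eq_L : ∀ t, 0 ≤ t → HasDerivWithinAt L
    (-(∑' n : ℤ, p t n * rateUp β c (L t) n) + Cl) (Ici 0) t
  eq_M : ∀ t, 0 ≤ t → HasDerivWithinAt M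
    ((∑' n : ℤ, p t n * rateDown β c (M t) n) - Cm) (Ici 0) t

/-- The same system, for equal constants `C`, in the variables `s = (L + M) / 2` and
`d = (L - M) / 2`. -/
structure SystemSD (β : ℤ → ℝ) (c C : ℝ) (p : ℝ → ℤ → ℝ) (s d : ℝ → ℝ) : Prop where
  eq_p : ∀ t, 0 ≤ t → ∀ n : ℤ, HasDerivWithinAt (fun u => p u n)
    (Real.exp (c * d t) *
      (β (n - 1) * Real.exp (c * (-(n : ℝ) + 1 + s t)) * p t (n - 1)
        - (β n * Real.exp (c * (-(n : ℝ) + s t))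
            + β (n - 1) * Real.exp (c * ((n : ℝ) - s t))) * p t n
        + β n * Real.exp (c * ((n : ℝ) + 1 - s t)) * p t (n + 1))) (Ici 0) t
  eq_s : ∀ t, 0 ≤ t → HasDerivWithinAt s
    (-(1 / 2) * Real.exp (c * d t) *
      ((∑' n : ℤ, p t n * β n * Real.exp (c * (-(n : ℝ) + s t)))
        - ∑' n : ℤ, p t n * β (n - 1) * Real.exp (c * ((n : ℝ) - s t)))) (Ici 0) t
  eq_d : ∀ t, 0 ≤ t → HasDerivWithinAt d
    (-(1 / 2) * Real.exp (c * d t) *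
      ((∑' n : ℤ, p t n * β n * Real.exp (c * (-(n : ℝ) + s t)))
        + ∑' n : ℤ, p t n * β (n - 1) * Real.exp (c * ((n : ℝ) - s t))) + C) (Ici 0) t

/-- The Cauchy problem on `[0, ∞)` for the system `Sys` with initial data `(p₀, L₀, M₀)` has a
solution in the class `InClass c α`, this solution is unique in that class, and its first component
is a probability measure at all times. -/
def UniqueGlobalSolution (c α : ℝ) (Sys : (ℝ → ℤ → ℝ) → (ℝ → ℝ) → (ℝ → ℝ) → Prop)
    (p₀ : ℤ → ℝ) (L₀ M₀ : ℝ) : Prop :=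
  ∃ (p : ℝ → ℤ → ℝ) (L M : ℝ → ℝ),
    (InClass c α p L M ∧ Sys p L M ∧ p 0 = p₀ ∧ L 0 = L₀ ∧ M 0 = M₀) ∧
    (∀ t, 0 ≤ t → IsProb (p t)) ∧
    ∀ (q : ℝ → ℤ → ℝ) (L' M' : ℝ → ℝ),
      InClass c α q L' M' → Sys q L' M' → q 0 = p₀ → L' 0 = L₀ → M' 0 = M₀ →
        ∀ t, 0 ≤ t → q t = p t ∧ L' t = L t ∧ M' t = M t

end NonlinearWalk

end

namespace NonlinearWalk

/-! ### Scalar linear equations on the half-line -/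

/-! Put `u = exp (-c L)` and `v = exp (c M)`. The jump rates become `a n / u` and `b n / v` with
fixed sequences `a`, `b`, and the equations for `L`, `M` become linear: `u' = -c Cl u + c ∑ p a` and
`v' = -c Cm v + c ∑ p b`. For `p ≥ 0` the sums are nonnegative, so `u` and `v` decay at most
exponentially. The rate factors `1 / u`, `1 / v` are therefore bounded a priori on every `[0, T]`,
which excludes blow-up.

The rates are unbounded in `n`, but the Gaussian weight `w` is adapted to them: one jump changes `w`
by just the factor that compensates the rate, so the gain operator is bounded on `ℓ¹(w)`
(`gainBound_weight`). The loss operator is unbounded but has a good sign. It is kept on the left of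
each scalar equation and dropped in upper bounds (`abs_le_of_linear`). Where its size matters, it is
bounded from `ℓ¹(w)` to a weaker space `ℓ¹(w')`.

All estimates are pointwise in `n`. A nonnegative element of `ℓ¹(w)` has a majorant `h` there with
`gain h ≤ 4 K h` (`GainBound.exists_majorant`), and `h exp (4 K X t)` is then a barrier for the
whole iteration, `X` being a bound for `1 / u` and `1 / v`. Differences are measured against a
majorant `g` in `ℓ¹(w')` times `exp (κ t)`; for large `κ` one step halves them (`Step.contraction`).
This gives existence, and also uniqueness among locally dominated solutions, since a solution is its
own next iterate. Every solution in the given class is locally dominated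
(`GainBound.locDom_of_step`).

Mass is conserved by telescoping, `C²` regularity follows by differentiating the linear functionals
once more, and the `(s, d)` system is the same system in other coordinates. -/

theorem exists_primitive {r : ℝ → ℝ} (hr : ContinuousOn r (Ici 0)) :
    ∃ R : ℝ → ℝ, R 0 = 0 ∧ ∀ t, 0 ≤ t → HasDerivWithinAt R (r t) (Ici 0) t := by
  -- Freezing `r` at its value at `0` for negative times gives an integrand continuous on the whole
  -- line, without changing it on `[0, ∞)`.
  have hc : Continuous fun s : ℝ => r (max s 0) :=
    hr.comp_continuous (by fun_prop) fun s => le_max_right s 0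
  refine ⟨fun t => ∫ s in (0 : ℝ)..t, r (max s 0), by simp, fun t ht => ?_⟩
  have h := (intervalIntegral.integral_hasDerivAt_right (hc.intervalIntegrable 0 t)
    hc.stronglyMeasurable.stronglyMeasurableAtFilter hc.continuousAt).hasDerivWithinAt (s := Ici 0)
  simpa [max_eq_left ht] using h

theorem exists_linear_solution {r f : ℝ → ℝ} (hr : ContinuousOn r (Ici 0))
    (hf : ContinuousOn f (Ici 0)) (y₀ : ℝ) :
    ∃ y : ℝ → ℝ, y 0 = y₀ ∧
      ∀ t, 0 ≤ t → HasDerivWithinAt y (-r t * y t + f t) (Ici 0) t := by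
  obtain ⟨R, hR0, hR⟩ := exists_primitive hr
  have hRc : ContinuousOn R (Ici 0) := fun t ht => (hR t ht).continuousWithinAt
  obtain ⟨Q, hQ0, hQ⟩ := exists_primitive (r := fun t => Real.exp (R t) * f t) (hRc.rexp.mul hf)
  refine ⟨fun t => Real.exp (-R t) * (y₀ + Q t), by simp [hR0, hQ0], fun t ht => ?_⟩
  have h := ((hR t ht).fun_neg.exp).mul ((hQ t ht).const_add y₀)
  refine h.congr_deriv ?_
  have : Real.exp (-R t) * Real.exp (R t) = 1 := by rw [← Real.exp_add]; simp
  linear_combination (f t) * this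

/-- With `R` a primitive of `r`, the product `exp R * z` is nondecreasing. The sign of `r` plays no
role. -/
theorem nonneg_of_linear {r z g : ℝ → ℝ} {T : ℝ} (hr : ContinuousOn r (Ici 0))
    (hz : ∀ t, 0 ≤ t → HasDerivWithinAt z (-r t * z t + g t) (Ici 0) t)
    (hg : ∀ t ∈ Icc 0 T, 0 ≤ g t) (hz0 : 0 ≤ z 0) : ∀ t ∈ Icc 0 T, 0 ≤ z t := by
  obtain ⟨R, hR0, hR⟩ := exists_primitive hr
  have hd : ∀ t, 0 ≤ t →
      HasDerivWithinAt (fun t => Real.exp (R t) * z t) (Real.exp (R t) * g t) (Ici 0) t := by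
    intro t ht
    exact (((hR t ht).exp).mul (hz t ht)).congr_deriv (by ring)
  have hmono : MonotoneOn (fun t => Real.exp (R t) * z t) (Icc 0 T) := by
    refine monotoneOn_of_deriv_nonneg (convex_Icc 0 T)
      (fun t ht => ((hd t ht.1).continuousWithinAt).mono Icc_subset_Ici_self) ?_ ?_
    all_goals
      intro t ht
      rw [interior_Icc] at ht
      have h := (hd t ht.1.le).hasDerivAt (Ici_mem_nhds ht.1)
    · exact h.differentiableAt.differentiableWithinAt
    · rw [h.deriv]
      exact mul_nonneg (Real.exp_pos _).le (hg t ⟨ht.1.le, ht.2.le⟩)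
  intro t ht
  have h := hmono ⟨le_rfl, ht.1.trans ht.2⟩ ht ht.1
  simp only [hR0, Real.exp_zero, one_mul] at h
  exact (mul_nonneg_iff_of_pos_left (Real.exp_pos (R t))).1 (hz0.trans h)

/-- Both `E - y` and `E + y` solve the equation with a nonnegative source, because `r E ≥ 0`. The
bound does not depend on the size of `r`; this is how unbounded loss rates are tolerated. -/
theorem abs_le_of_linear {r y f E E' : ℝ → ℝ} {T : ℝ} (hr : ContinuousOn r (Ici 0))
    (hr0 : ∀ t ∈ Icc 0 T, 0 ≤ r t)
    (hy : ∀ t, 0 ≤ t → HasDerivWithinAt y (-r t * y t + f t) (Ici 0) t)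
    (hE : ∀ t, 0 ≤ t → HasDerivWithinAt E (E' t) (Ici 0) t)
    (hE0 : ∀ t ∈ Icc 0 T, 0 ≤ E t) (hf : ∀ t ∈ Icc 0 T, |f t| ≤ E' t) (h0 : |y 0| ≤ E 0) :
    ∀ t ∈ Icc 0 T, |y t| ≤ E t := by
  have h1 := nonneg_of_linear (T := T) (z := fun t => E t - y t)
    (g := fun t => r t * E t + (E' t - f t)) hr
    (fun t ht => ((hE t ht).sub (hy t ht)).congr_deriv (by ring))
    (fun t ht => add_nonneg (mul_nonneg (hr0 t ht) (hE0 t ht))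
      (by linarith [hf t ht, le_abs_self (f t)]))
    (by linarith [le_abs_self (y 0)])
  have h2 := nonneg_of_linear (T := T) (z := fun t => E t + y t)
    (g := fun t => r t * E t + (E' t + f t)) hr
    (fun t ht => ((hE t ht).add (hy t ht)).congr_deriv (by ring))
    (fun t ht => add_nonneg (mul_nonneg (hr0 t ht) (hE0 t ht))
      (by linarith [hf t ht, neg_abs_le (f t)]))
    (by linarith [neg_abs_le (y 0)])
  intro t ht
  rw [abs_le]
  constructor <;> linarith [h1 t ht, h2 t ht]

theorem abs_le_exp_of_linear {r y f : ℝ → ℝ} {T κ D : ℝ} (hD : 0 ≤ D)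
    (hr : ContinuousOn r (Ici 0)) (hr0 : ∀ t ∈ Icc 0 T, 0 ≤ r t)
    (hy : ∀ t, 0 ≤ t → HasDerivWithinAt y (-r t * y t + f t) (Ici 0) t)
    (hf : ∀ t ∈ Icc 0 T, |f t| ≤ κ * (D * Real.exp (κ * t))) (h0 : |y 0| ≤ D) :
    ∀ t ∈ Icc 0 T, |y t| ≤ D * Real.exp (κ * t) := by
  refine abs_le_of_linear (E' := fun t => κ * (D * Real.exp (κ * t))) hr hr0 hy
    (fun t _ => ?_) (fun t _ => by positivity) hf (by simpa using h0)
  have h := ((((hasDerivAt_id t).const_mul κ).exp).const_mul D).hasDerivWithinAt (s := Ici 0)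
  exact h.congr_deriv (by simp; ring)

/-! ### Slowly varying majorants -/

/-- Convolve `F` with `2 ^ (-|k|)`: the kernel is summable, changes by at most a factor `2` under a
unit shift, and equals `1` at `0`. -/
theorem exists_slowly_varying_majorant {F : ℤ → ℝ} (hF0 : ∀ n, 0 ≤ F n) (hF : Summable F) :
    ∃ E : ℤ → ℝ, Summable E ∧ (∀ n, F n ≤ E n) ∧ (∀ n, E (n + 1) ≤ 2 * E n) ∧
      ∀ n, E (n - 1) ≤ 2 * E n := by
  have hθ : Summable fun k : ℤ => (1 / 2 : ℝ) ^ k.natAbs := by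
    have h := summable_geometric_of_lt_one (r := (1 / 2 : ℝ)) (by norm_num) (by norm_num)
    refine Summable.of_nat_of_neg ?_ ?_ <;> simpa using h
  -- The shear `(n, m) ↦ (n - m, m)` turns the convolution into a product of two summable families.
  let e : ℤ × ℤ ≃ ℤ × ℤ :=
    { toFun := fun x => (x.1 - x.2, x.2)
      invFun := fun x => (x.1 + x.2, x.2)
      left_inv := fun x => by simp
      right_inv := fun x => by simp }
  have hs : Summable fun x : ℤ × ℤ => (1 / 2 : ℝ) ^ (x.1 - x.2).natAbs * F x.2 :=
    (e.summable_iff (f := fun x : ℤ × ℤ => (1 / 2 : ℝ) ^ x.1.natAbs * F x.2)).2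
      (hθ.mul_of_nonneg hF (fun _ => by positivity) hF0)
  have hn : ∀ n, Summable fun m : ℤ => (1 / 2 : ℝ) ^ (n - m).natAbs * F m :=
    fun n => hs.prod_factor n
  have hstep : ∀ i j : ℤ, j.natAbs ≤ i.natAbs + 1 →
      (1 / 2 : ℝ) ^ i.natAbs ≤ 2 * (1 / 2 : ℝ) ^ j.natAbs := by
    intro i j hij
    have := pow_le_pow_of_le_one (a := (1 / 2 : ℝ)) (by norm_num) (by norm_num) hij
    rw [pow_succ] at this
    linarith
  have hshift : ∀ n n' : ℤ, (∀ m, (n - m).natAbs ≤ (n' - m).natAbs + 1) →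
      ∑' m : ℤ, (1 / 2 : ℝ) ^ (n' - m).natAbs * F m
        ≤ 2 * ∑' m : ℤ, (1 / 2 : ℝ) ^ (n - m).natAbs * F m := by
    intro n n' h
    rw [← tsum_mul_left]
    refine (hn n').tsum_le_tsum (fun m => ?_) ((hn n).mul_left 2)
    rw [← mul_assoc]
    exact mul_le_mul_of_nonneg_right (hstep _ _ (h m)) (hF0 m)
  refine ⟨fun n => ∑' m : ℤ, (1 / 2 : ℝ) ^ (n - m).natAbs * F m, hs.prod, fun n => ?_,
    fun n => hshift n (n + 1) fun m => by omega, fun n => hshift n (n - 1) fun m => by omega⟩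
  have := (hn n).le_tsum n fun m _ => mul_nonneg (by positivity) (hF0 m)
  simpa using this

/-! ### The gain operator on weighted spaces -/

/-- The gain part of the generator of the walk with jump rates `a` upwards and `b` downwards. -/
def gain (a b h : ℤ → ℝ) (n : ℤ) : ℝ :=
  a (n - 1) * h (n - 1) + b (n + 1) * h (n + 1)

theorem gain_nonneg {a b h : ℤ → ℝ} (ha : ∀ n, 0 ≤ a n) (hb : ∀ n, 0 ≤ b n)
    (hh : ∀ n, 0 ≤ h n) (n : ℤ) : 0 ≤ gain a b h n :=
  add_nonneg (mul_nonneg (ha _) (hh _)) (mul_nonneg (hb _) (hh _))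

/-- The gain operator of the rates `a`, `b` is bounded on the `ℓ¹` space with weight `w`. -/
structure GainBound (a b w : ℤ → ℝ) (K : ℝ) : Prop where
  a_nonneg : ∀ n, 0 ≤ a n
  b_nonneg : ∀ n, 0 ≤ b n
  w_pos : ∀ n, 0 < w n
  up : ∀ n, a n * w (n + 1) ≤ K * w n
  down : ∀ n, b n * w (n - 1) ≤ K * w n

namespace GainBound

variable {a b w : ℤ → ℝ} {K : ℝ}

theorem gain_mul_le (hG : GainBound a b w K) {h : ℤ → ℝ} (hh : ∀ n, 0 ≤ h n) (n : ℤ) :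
    gain a b h n * w n ≤ K * (h (n - 1) * w (n - 1)) + K * (h (n + 1) * w (n + 1)) := by
  have h1 := mul_le_mul_of_nonneg_left (hG.up (n - 1)) (hh (n - 1))
  have h2 := mul_le_mul_of_nonneg_left (hG.down (n + 1)) (hh (n + 1))
  rw [sub_add_cancel] at h1
  rw [add_sub_cancel_right] at h2
  unfold gain
  linarith

theorem summable_shift {f : ℤ → ℝ} (hf : Summable f) (k : ℤ) : Summable fun n => f (n + k) :=
  (Equiv.addRight k).summable_iff.2 hf

theorem tsum_shift (f : ℤ → ℝ) (k : ℤ) : ∑' n, f (n + k) = ∑' n, f n :=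
  (Equiv.addRight k).tsum_eq f

theorem summable_gain (hG : GainBound a b w K) {h : ℤ → ℝ} (hh : ∀ n, 0 ≤ h n)
    (hs : Summable fun n => h n * w n) :
    Summable (fun n => gain a b h n * w n) ∧
      ∑' n, gain a b h n * w n ≤ 2 * K * ∑' n, h n * w n := by
  have h1 := (summable_shift hs (-1)).mul_left K
  have h2 := (summable_shift hs 1).mul_left K
  have hle : ∀ n, gain a b h n * w n
      ≤ K * (h (n + -1) * w (n + -1)) + K * (h (n + 1) * w (n + 1)) := hG.gain_mul_le hh
  have hsum : Summable (fun n => gain a b h n * w n) :=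
    Summable.of_nonneg_of_le
      (fun n => mul_nonneg (gain_nonneg hG.a_nonneg hG.b_nonneg hh n) (hG.w_pos n).le)
      hle (h1.add h2)
  refine ⟨hsum, (hsum.tsum_le_tsum hle (h1.add h2)).trans ?_⟩
  rw [h1.tsum_add h2, tsum_mul_left, tsum_mul_left, tsum_shift (fun n => h n * w n),
    tsum_shift (fun n => h n * w n)]
  linarith

/-- Take a slowly varying majorant `E` of `f w` and set `h = E / w`. Each of the two neighbours
contributes at most `K * 2 E` to `gain h * w`, whence `4 K`. -/
theorem exists_majorant (hG : GainBound a b w K) {f : ℤ → ℝ} (hf : ∀ n, 0 ≤ f n)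
    (hs : Summable fun n => f n * w n) :
    ∃ h : ℤ → ℝ, (∀ n, f n ≤ h n) ∧ (Summable fun n => h n * w n) ∧
      ∀ n, gain a b h n ≤ 4 * K * h n := by
  obtain ⟨E, hE, hfE, hp, hm⟩ :=
    exists_slowly_varying_majorant (fun n => mul_nonneg (hf n) (hG.w_pos n).le) hs
  have hEw : ∀ n, E n / w n * w n = E n := fun n => div_mul_cancel₀ _ (hG.w_pos n).ne'
  have hE0 : ∀ n, 0 ≤ E n := fun n => (mul_nonneg (hf n) (hG.w_pos n).le).trans (hfE n)
  have hK : 0 ≤ K := by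
    have := (mul_nonneg (hG.a_nonneg 0) (hG.w_pos (0 + 1)).le).trans (hG.up 0)
    exact (mul_nonneg_iff_of_pos_right (hG.w_pos 0)).1 this
  refine ⟨fun n => E n / w n, fun n => (le_div_iff₀ (hG.w_pos n)).2 (hfE n), by simpa [hEw], ?_⟩
  intro n
  have h := hG.gain_mul_le (h := fun n => E n / w n)
    (fun n => div_nonneg (hE0 n) (hG.w_pos n).le) n
  simp only [hEw] at h
  rw [← mul_div_assoc, le_div_iff₀ (hG.w_pos n)]
  nlinarith [mul_le_mul_of_nonneg_left (hp n) hK, mul_le_mul_of_nonneg_left (hm n) hK]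

end GainBound

/-- The rates `a`, `b` are compatible with the strong weight `w` and the weak weight `w'`: the gain
operator is bounded for both, the loss operator loses at most the quotient of the weights, and the
relevant linear functionals are bounded for the weak weight. -/
structure Admissible (a b w w' : ℤ → ℝ) (K : ℝ) : Prop where
  strong : GainBound a b w K
  weak : GainBound a b w' K
  weak_le : ∀ n, w' n ≤ K * w n
  loss : ∀ n, (a n + b n) * w' n ≤ K * w n
  a_le : ∀ n, a n ≤ K * w' n
  b_le : ∀ n, b n ≤ K * w' n
  one_le : ∀ n, 1 ≤ K * w' n

theorem Summable.mul_of_weight_le {f w φ : ℤ → ℝ} {K : ℝ} (hf : ∀ n, 0 ≤ f n)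
    (hs : Summable fun n => f n * w n) (hφ : ∀ n, 0 ≤ φ n) (hle : ∀ n, φ n ≤ K * w n) :
    Summable fun n => f n * φ n :=
  Summable.of_nonneg_of_le (fun n => mul_nonneg (hf n) (hφ n))
    (fun n => (mul_le_mul_of_nonneg_left (hle n) (hf n)).trans_eq (by ring)) (hs.mul_left K)

/-- `g` majorizes the increments of solutions that are dominated by `H`. -/
structure DiffMajorant (a b H g : ℤ → ℝ) (k : ℝ) : Prop where
  H_nonneg : ∀ n, 0 ≤ H n
  H_le : ∀ n, H n ≤ g n
  rate_le : ∀ n, (a n + b n) * H n + gain a b H n ≤ g n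
  gain_le : ∀ n, gain a b g n ≤ k * g n
  summable_a : Summable fun n => g n * a n
  summable_b : Summable fun n => g n * b n

theorem Admissible.summable_rate {a b w w' : ℤ → ℝ} {K : ℝ} (hA : Admissible a b w w' K)
    {H : ℤ → ℝ} (hH : ∀ n, 0 ≤ H n) (hs : Summable fun n => H n * w n) :
    Summable fun n => ((a n + b n) * H n + gain a b H n) * w' n := by
  have h1 : Summable fun n => H n * w' n :=
    Summable.mul_of_weight_le hH hs (fun n => (hA.weak.w_pos n).le) hA.weak_le
  have h2 : Summable fun n => H n * ((a n + b n) * w' n) :=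
    Summable.mul_of_weight_le hH hs (fun n => mul_nonneg
      (add_nonneg (hA.weak.a_nonneg n) (hA.weak.b_nonneg n)) (hA.weak.w_pos n).le) hA.loss
  refine (h2.add (hA.weak.summable_gain hH h1).1).congr fun n => ?_
  ring

/-- The majorant is taken in the weak weight because the loss term of `H ∈ ℓ¹(w)` is only known to
lie in `ℓ¹(w')`. -/
theorem Admissible.exists_diffMajorant {a b w w' : ℤ → ℝ} {K : ℝ} (hA : Admissible a b w w' K)
    {H : ℤ → ℝ} (hH : ∀ n, 0 ≤ H n) (hs : Summable fun n => H n * w n) :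
    ∃ g, DiffMajorant a b H g (4 * K) := by
  have h1 : Summable fun n => H n * w' n :=
    Summable.mul_of_weight_le hH hs (fun n => (hA.weak.w_pos n).le) hA.weak_le
  have hr : ∀ n, 0 ≤ (a n + b n) * H n + gain a b H n := fun n =>
    add_nonneg (mul_nonneg (add_nonneg (hA.weak.a_nonneg n) (hA.weak.b_nonneg n)) (hH n))
      (gain_nonneg hA.weak.a_nonneg hA.weak.b_nonneg hH n)
  obtain ⟨g, hg, hgs, hgg⟩ := hA.weak.exists_majorant
    (f := fun n => H n + ((a n + b n) * H n + gain a b H n))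
    (fun n => add_nonneg (hH n) (hr n))
    ((h1.add (hA.summable_rate hH hs)).congr fun n => by ring)
  have hHg : ∀ n, H n ≤ g n := fun n => (le_add_of_nonneg_right (hr n)).trans (hg n)
  have hg0 : ∀ n, 0 ≤ g n := fun n => (hH n).trans (hHg n)
  exact ⟨g, hH, hHg, fun n => (le_add_of_nonneg_left (hH n)).trans (hg n), hgg,
    Summable.mul_of_weight_le hg0 hgs hA.weak.a_nonneg hA.a_le,
    Summable.mul_of_weight_le hg0 hgs hA.weak.b_nonneg hA.b_le⟩

/-! ### One step of the iteration -/

/-- `(P, U, V)` solves the linear equations in which the loss rates and the gains are computed from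
`(p, u, v)`. Here `u` and `v` stand for `exp (-c L)` and `exp (c M)`. -/
structure Step (a b : ℤ → ℝ) (c kl km : ℝ) (p : ℝ → ℤ → ℝ) (u v : ℝ → ℝ)
    (P : ℝ → ℤ → ℝ) (U V : ℝ → ℝ) : Prop where
  eq_p : ∀ t, 0 ≤ t → ∀ n, HasDerivWithinAt (fun s => P s n)
    (-(a n * (u t)⁻¹ + b n * (v t)⁻¹) * P t n
      + (a (n - 1) * (u t)⁻¹ * p t (n - 1) + b (n + 1) * (v t)⁻¹ * p t (n + 1))) (Ici 0) t
  eq_u : ∀ t, 0 ≤ t → HasDerivWithinAt U (-kl * U t + c * ∑' n, p t n * a n) (Ici 0) t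
  eq_v : ∀ t, 0 ≤ t → HasDerivWithinAt V (-km * V t + c * ∑' n, p t n * b n) (Ici 0) t

/-- On `[0, T]` the two triples differ by at most `ε exp (κ t)` times `(g, 1, 1)`. -/
def Close (T κ ε : ℝ) (g : ℤ → ℝ) (p : ℝ → ℤ → ℝ) (u v : ℝ → ℝ) (q : ℝ → ℤ → ℝ)
    (u' v' : ℝ → ℝ) : Prop :=
  ∀ t ∈ Icc 0 T, (∀ n, |p t n - q t n| ≤ ε * Real.exp (κ * t) * g n) ∧
    |u t - u' t| ≤ ε * Real.exp (κ * t) ∧ |v t - v' t| ≤ ε * Real.exp (κ * t)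

theorem abs_inv_sub_inv_le {x y X δ : ℝ} (hx : 0 < x) (hy : 0 < y) (hxX : x⁻¹ ≤ X)
    (hyX : y⁻¹ ≤ X) (h : |x - y| ≤ δ) : |x⁻¹ - y⁻¹| ≤ X ^ 2 * δ := by
  have he : x⁻¹ - y⁻¹ = x⁻¹ * y⁻¹ * (y - x) := by field_simp
  rw [he, abs_mul, abs_of_pos (by positivity), abs_sub_comm]
  have hX : 0 ≤ X := (inv_pos.2 hx).le.trans hxX
  refine mul_le_mul ?_ h (abs_nonneg _) (by positivity)
  rw [pow_two]
  exact mul_le_mul hxX hyX (inv_pos.2 hy).le hX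

theorem abs_tsum_sub_tsum_le {p q g H φ : ℤ → ℝ} {e : ℝ} (hφ : ∀ n, 0 ≤ φ n)
    (hg : Summable fun n => g n * φ n) (hHg : ∀ n, H n ≤ g n) (hq : ∀ n, |q n| ≤ H n)
    (h : ∀ n, |p n - q n| ≤ e * g n) :
    |∑' n, p n * φ n - ∑' n, q n * φ n| ≤ e * ∑' n, g n * φ n := by
  have hbd : ∀ n, ‖(p n - q n) * φ n‖ ≤ e * (g n * φ n) := fun n => by
    rw [Real.norm_eq_abs, abs_mul, abs_of_nonneg (hφ n), ← mul_assoc]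
    exact mul_le_mul_of_nonneg_right (h n) (hφ n)
  have hqs : Summable fun n => q n * φ n := Summable.of_norm_bounded hg fun n => by
    rw [Real.norm_eq_abs, abs_mul, abs_of_nonneg (hφ n)]
    exact mul_le_mul_of_nonneg_right ((hq n).trans (hHg n)) (hφ n)
  have hds : Summable fun n => (p n - q n) * φ n := Summable.of_norm_bounded (hg.mul_left e) hbd
  have hps : Summable fun n => p n * φ n := (hds.add hqs).congr fun n => by ring
  rw [← hps.tsum_sub hqs, ← tsum_mul_left]
  refine (congrArg abs (tsum_congr fun n => by ring)).trans_le
    (tsum_of_norm_bounded (hg.mul_left e).hasSum hbd)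

section Contraction

variable {a b H g : ℤ → ℝ} {c kl km k X T κ ε : ℝ} {p q P Q : ℝ → ℤ → ℝ}
  {u v u' v' U V U' V' : ℝ → ℝ}

/-- The loss rates of the first triple stay on the left. What remains is linear in the differences
of the inputs, with coefficients controlled by `g`, and integration against `exp (κ t)` gains a
factor `1 / κ`, which is small enough to halve the error. -/
theorem Step.contraction (ha : ∀ n, 0 ≤ a n) (hb : ∀ n, 0 ≤ b n) (hc : 0 ≤ c) (hkl : 0 ≤ kl)
    (hkm : 0 ≤ km) (h₁ : Step a b c kl km p u v P U V) (h₂ : Step a b c kl km q u' v' Q U' V')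
    (hP : P 0 = Q 0) (hU : U 0 = U' 0) (hV : V 0 = V' 0)
    (hu : ContinuousOn u (Ici 0)) (hv : ContinuousOn v (Ici 0))
    (hu0 : ∀ t, 0 ≤ t → 0 < u t) (hv0 : ∀ t, 0 ≤ t → 0 < v t)
    (hu0' : ∀ t, 0 ≤ t → 0 < u' t) (hv0' : ∀ t, 0 ≤ t → 0 < v' t)
    (huX : ∀ t ∈ Icc 0 T, (u t)⁻¹ ≤ X) (hvX : ∀ t ∈ Icc 0 T, (v t)⁻¹ ≤ X)
    (huX' : ∀ t ∈ Icc 0 T, (u' t)⁻¹ ≤ X) (hvX' : ∀ t ∈ Icc 0 T, (v' t)⁻¹ ≤ X)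
    (hM : DiffMajorant a b H g k)
    (hq : ∀ t ∈ Icc 0 T, ∀ n, |q t n| ≤ H n) (hQ : ∀ t ∈ Icc 0 T, ∀ n, |Q t n| ≤ H n)
    (hκ : 2 * (k * X + X ^ 2) ≤ κ) (hκa : 2 * (c * ∑' n, g n * a n) ≤ κ)
    (hκb : 2 * (c * ∑' n, g n * b n) ≤ κ) (hε : 0 ≤ ε)
    (hclose : Close T κ ε g p u v q u' v') : Close T κ (ε / 2) g P U V Q U' V' := by
  have hg0 : ∀ n, 0 ≤ g n := fun n => (hM.H_nonneg n).trans (hM.H_le n)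
  have hscal : ∀ {y f : ℝ → ℝ} {l S : ℝ}, 0 ≤ l → 2 * S ≤ κ →
      (∀ t, 0 ≤ t → HasDerivWithinAt y (-l * y t + f t) (Ici 0) t) → y 0 = 0 →
      (∀ t ∈ Icc 0 T, |f t| ≤ ε * Real.exp (κ * t) * S) →
      ∀ t ∈ Icc 0 T, |y t| ≤ ε / 2 * Real.exp (κ * t) := by
    intro y f l S hl hS hy hy0 hf
    refine abs_le_exp_of_linear (r := fun _ => l) (by positivity) continuousOn_const
      (fun _ _ => hl) hy (fun t ht => (hf t ht).trans ?_) (by rw [hy0, abs_zero]; positivity)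
    have h := mul_le_mul_of_nonneg_left hS (mul_nonneg hε (Real.exp_pos (κ * t)).le)
    linarith
  intro t ht
  refine ⟨fun n => ?_, ?_, ?_⟩
  · have hr0 : ∀ s ∈ Icc 0 T, 0 ≤ a n * (u s)⁻¹ + b n * (v s)⁻¹ := fun s hs =>
      add_nonneg (mul_nonneg (ha n) (inv_pos.2 (hu0 s hs.1)).le)
        (mul_nonneg (hb n) (inv_pos.2 (hv0 s hs.1)).le)
    have hr : ContinuousOn (fun s => a n * (u s)⁻¹ + b n * (v s)⁻¹) (Ici 0) :=
      ((hu.inv₀ fun s hs => (hu0 s hs).ne').const_mul (a n)).add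
        ((hv.inv₀ fun s hs => (hv0 s hs).ne').const_mul (b n))
    -- The first two terms of `f` are the gain of `p - q`. The last two come from changing `1 / u'`,
    -- `1 / v'` into `1 / u`, `1 / v` in the second equation; there the loss acts on `Q`, which `H`
    -- dominates, and not on `P - Q`.
    have key := abs_le_exp_of_linear (y := fun s => P s n - Q s n) (κ := κ) (D := ε / 2 * g n)
      (T := T)
      (f := fun s => a (n - 1) * (u s)⁻¹ * (p s (n - 1) - q s (n - 1))
        + b (n + 1) * (v s)⁻¹ * (p s (n + 1) - q s (n + 1))
        + ((u s)⁻¹ - (u' s)⁻¹) * (a (n - 1) * q s (n - 1) - a n * Q s n)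
        + ((v s)⁻¹ - (v' s)⁻¹) * (b (n + 1) * q s (n + 1) - b n * Q s n))
      (mul_nonneg (by positivity) (hg0 n)) hr hr0
      (fun s hs => ((h₁.eq_p s hs n).sub (h₂.eq_p s hs n)).congr_deriv (by ring)) ?_
      (by rw [hP, sub_self, abs_zero]; exact mul_nonneg (by positivity) (hg0 n)) t ht
    · linarith
    intro s hs
    obtain ⟨hps, hus, hvs⟩ := hclose s hs
    set e := ε * Real.exp (κ * s) with he
    have he0 : 0 ≤ e := by positivity
    have hX : 0 ≤ X := (inv_pos.2 (hu0 s hs.1)).le.trans (huX s hs)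
    have hiu := abs_inv_sub_inv_le (hu0 s hs.1) (hu0' s hs.1) (huX s hs) (huX' s hs) hus
    have hiv := abs_inv_sub_inv_le (hv0 s hs.1) (hv0' s hs.1) (hvX s hs) (hvX' s hs) hvs
    have b1 : |a (n - 1) * (u s)⁻¹ * (p s (n - 1) - q s (n - 1))|
        ≤ a (n - 1) * X * (e * g (n - 1)) := by
      rw [abs_mul, abs_mul, abs_of_nonneg (ha _), abs_of_pos (inv_pos.2 (hu0 s hs.1))]
      exact mul_le_mul (mul_le_mul_of_nonneg_left (huX s hs) (ha _)) (hps _) (abs_nonneg _)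
        (mul_nonneg (ha _) hX)
    have b2 : |b (n + 1) * (v s)⁻¹ * (p s (n + 1) - q s (n + 1))|
        ≤ b (n + 1) * X * (e * g (n + 1)) := by
      rw [abs_mul, abs_mul, abs_of_nonneg (hb _), abs_of_pos (inv_pos.2 (hv0 s hs.1))]
      exact mul_le_mul (mul_le_mul_of_nonneg_left (hvX s hs) (hb _)) (hps _) (abs_nonneg _)
        (mul_nonneg (hb _) hX)
    have hdiff : ∀ {x y : ℝ} {m : ℤ}, 0 ≤ x → 0 ≤ y →
        |x * q s m - y * Q s n| ≤ x * H m + y * H n := by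
      intro x y m hx hy
      refine (abs_sub _ _).trans ?_
      rw [abs_mul, abs_mul, abs_of_nonneg hx, abs_of_nonneg hy]
      exact add_le_add (mul_le_mul_of_nonneg_left (hq s hs m) hx)
        (mul_le_mul_of_nonneg_left (hQ s hs n) hy)
    have b3 : |((u s)⁻¹ - (u' s)⁻¹) * (a (n - 1) * q s (n - 1) - a n * Q s n)|
        ≤ X ^ 2 * e * (a (n - 1) * H (n - 1) + a n * H n) := by
      rw [abs_mul]
      exact mul_le_mul hiu (hdiff (ha _) (ha _)) (abs_nonneg _) (by positivity)
    have b4 : |((v s)⁻¹ - (v' s)⁻¹) * (b (n + 1) * q s (n + 1) - b n * Q s n)|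
        ≤ X ^ 2 * e * (b (n + 1) * H (n + 1) + b n * H n) := by
      rw [abs_mul]
      exact mul_le_mul hiv (hdiff (hb _) (hb _)) (abs_nonneg _) (by positivity)
    -- The gain costs `k X e g` and the differences of inverses cost `X ^ 2 e g`; by `hκ` the total
    -- is at most `κ e g / 2`.
    have c1 := mul_le_mul_of_nonneg_left (hM.gain_le n) (mul_nonneg he0 hX)
    have c2 := mul_le_mul_of_nonneg_left (hM.rate_le n) (mul_nonneg (pow_nonneg hX 2) he0)
    have c3 := mul_le_mul_of_nonneg_right hκ (mul_nonneg he0 (hg0 n))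
    unfold gain at c1 c2
    refine (abs_add_le _ _).trans ?_
    refine (add_le_add_left ((abs_add_le _ _).trans
      (add_le_add_left (abs_add_le _ _) _)) _).trans ?_
    have e1 : κ * (ε / 2 * g n * Real.exp (κ * s)) = κ * (e * g n) / 2 := by rw [he]; ring
    rw [e1]
    linarith
  · refine hscal (y := fun s => U s - U' s) (S := c * ∑' n, g n * a n)
      (f := fun s => c * (∑' n, p s n * a n - ∑' n, q s n * a n)) hkl hκa
      (fun s hs => ((h₁.eq_u s hs).sub (h₂.eq_u s hs)).congr_deriv (by ring))
      (by rw [hU, sub_self]) (fun s hs => ?_) t ht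
    rw [abs_mul, abs_of_nonneg hc]
    have := mul_le_mul_of_nonneg_left
      (abs_tsum_sub_tsum_le ha hM.summable_a hM.H_le (hq s hs) (hclose s hs).1) hc
    linarith
  · refine hscal (y := fun s => V s - V' s) (S := c * ∑' n, g n * b n)
      (f := fun s => c * (∑' n, p s n * b n - ∑' n, q s n * b n)) hkm hκb
      (fun s hs => ((h₁.eq_v s hs).sub (h₂.eq_v s hs)).congr_deriv (by ring))
      (by rw [hV, sub_self]) (fun s hs => ?_) t ht
    rw [abs_mul, abs_of_nonneg hc]
    have := mul_le_mul_of_nonneg_left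
      (abs_tsum_sub_tsum_le hb hM.summable_b hM.H_le (hq s hs) (hclose s hs).1) hc
    linarith

end Contraction

/-! ### Locally dominated families of sequences -/

theorem continuousOn_Ici_of_Icc {E : Type*} [TopologicalSpace E] {f : ℝ → E}
    (h : ∀ T, ContinuousOn f (Icc 0 T)) : ContinuousOn f (Ici 0) := by
  intro t ht
  refine (h (t + 1) t ⟨ht, by linarith⟩).mono_of_mem_nhdsWithin ?_
  rw [← Ici_inter_Iic]
  exact inter_mem self_mem_nhdsWithin
    (mem_nhdsWithin_of_mem_nhds (Iic_mem_nhds (by linarith)))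

/-- On each `[0, T]` the family `p` is dominated by a single element of `ℓ¹(w)`. -/
def LocDom (w : ℤ → ℝ) (p : ℝ → ℤ → ℝ) : Prop :=
  ∀ T, ∃ H : ℤ → ℝ, (∀ n, 0 ≤ H n) ∧ (Summable fun n => H n * w n) ∧
    ∀ t ∈ Icc 0 T, ∀ n, |p t n| ≤ H n

theorem norm_mul_le_of_weight {x y H w K : ℝ} (hx : |x| ≤ H) (hy : |y| ≤ K * w) :
    ‖x * y‖ ≤ K * (H * w) := by
  rw [Real.norm_eq_abs, abs_mul]
  refine (mul_le_mul hx hy (abs_nonneg _) ((abs_nonneg _).trans hx)).trans_eq (by ring)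

theorem LocDom.summable {w φ : ℤ → ℝ} {p : ℝ → ℤ → ℝ} {K : ℝ} (hd : LocDom w p)
    (hφ : ∀ n, |φ n| ≤ K * w n) {t : ℝ} (ht : 0 ≤ t) : Summable fun n => p t n * φ n := by
  obtain ⟨H, -, hs, hH⟩ := hd t
  exact Summable.of_norm_bounded (hs.mul_left K) fun n =>
    norm_mul_le_of_weight (hH t ⟨ht, le_rfl⟩ n) (hφ n)

theorem LocDom.continuousOn_tsum {w φ : ℤ → ℝ} {p : ℝ → ℤ → ℝ} {K : ℝ} (hd : LocDom w p)
    (hp : ∀ n, ContinuousOn (fun t => p t n) (Ici 0)) (hφ : ∀ n, |φ n| ≤ K * w n) :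
    ContinuousOn (fun t => ∑' n, p t n * φ n) (Ici 0) := by
  refine continuousOn_Ici_of_Icc fun T => ?_
  obtain ⟨H, -, hs, hH⟩ := hd T
  exact _root_.continuousOn_tsum
    (fun n => ((hp n).mono Icc_subset_Ici_self).mul continuousOn_const) (hs.mul_left K)
    fun n t ht => norm_mul_le_of_weight (hH t ht n) (hφ n)

/-! ### Existence by successive approximation -/

/-- An upper bound on `[0, T]` for `1 / u` and `1 / v` along the iteration. -/
noncomputable def invBound (kl km u₀ v₀ T : ℝ) : ℝ :=
  u₀⁻¹ * Real.exp (kl * T) + v₀⁻¹ * Real.exp (km * T)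

/-- The invariants of the iteration that starts from `(p₀, u₀, v₀)`. -/
structure Iterate (h p₀ : ℤ → ℝ) (K kl km u₀ v₀ : ℝ) (p : ℝ → ℤ → ℝ) (u v : ℝ → ℝ) : Prop where
  init_p : p 0 = p₀
  init_u : u 0 = u₀
  init_v : v 0 = v₀
  cont_p : ∀ n, ContinuousOn (fun t => p t n) (Ici 0)
  cont_u : ContinuousOn u (Ici 0)
  cont_v : ContinuousOn v (Ici 0)
  p_nonneg : ∀ t, 0 ≤ t → ∀ n, 0 ≤ p t n
  p_le : ∀ T, ∀ t ∈ Icc 0 T, ∀ n,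
    p t n ≤ h n * Real.exp (4 * K * invBound kl km u₀ v₀ T * t)
  u_ge : ∀ t, 0 ≤ t → u₀ * Real.exp (-kl * t) ≤ u t
  v_ge : ∀ t, 0 ≤ t → v₀ * Real.exp (-km * t) ≤ v t

/-- Subtract the free solution: the difference has a nonnegative source. Applied to `u` and `v`,
this is the a priori bound on the rates. -/
theorem linear_ge_exp {y f : ℝ → ℝ} {l y₀ : ℝ} (hy0 : y 0 = y₀)
    (hy : ∀ t, 0 ≤ t → HasDerivWithinAt y (-l * y t + f t) (Ici 0) t)
    (hf : ∀ t, 0 ≤ t → 0 ≤ f t) (t : ℝ) (ht : 0 ≤ t) : y₀ * Real.exp (-l * t) ≤ y t := by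
  have h := nonneg_of_linear (T := t) (r := fun _ => l) (g := f)
    (z := fun s => y s - y₀ * Real.exp (-l * s)) continuousOn_const (fun s hs => ?_)
    (fun s hs => hf s hs.1) (by simp [hy0]) t ⟨ht, le_rfl⟩
  · linarith
  · have he := ((((hasDerivAt_id s).const_mul (-l)).exp).const_mul y₀).hasDerivWithinAt
      (s := Ici 0)
    exact ((hy s hs).sub he).congr_deriv (by simp; ring)

theorem inv_le_of_exp_le {y y₀ l t T : ℝ} (hy₀ : 0 < y₀) (hl : 0 ≤ l) (htT : t ≤ T)
    (h : y₀ * Real.exp (-l * t) ≤ y) : y⁻¹ ≤ y₀⁻¹ * Real.exp (l * T) := by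
  have h1 : y⁻¹ ≤ (y₀ * Real.exp (-l * t))⁻¹ := inv_anti₀ (by positivity) h
  rw [mul_inv, ← Real.exp_neg] at h1
  refine h1.trans (mul_le_mul_of_nonneg_left (Real.exp_le_exp.2 ?_) (by positivity))
  have := mul_le_mul_of_nonneg_left htT hl
  linarith

namespace Iterate

variable {a b w w' h p₀ : ℤ → ℝ} {K c kl km u₀ v₀ : ℝ} {p : ℝ → ℤ → ℝ} {u v : ℝ → ℝ}

theorem u_pos (hI : Iterate h p₀ K kl km u₀ v₀ p u v) (hu₀ : 0 < u₀) (t : ℝ) (ht : 0 ≤ t) :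
    0 < u t :=
  lt_of_lt_of_le (by positivity) (hI.u_ge t ht)

theorem v_pos (hI : Iterate h p₀ K kl km u₀ v₀ p u v) (hv₀ : 0 < v₀) (t : ℝ) (ht : 0 ≤ t) :
    0 < v t :=
  lt_of_lt_of_le (by positivity) (hI.v_ge t ht)

theorem inv_u_le (hI : Iterate h p₀ K kl km u₀ v₀ p u v) (hu₀ : 0 < u₀) (hv₀ : 0 < v₀)
    (hkl : 0 ≤ kl) {T : ℝ} (t : ℝ) (ht : t ∈ Icc 0 T) : (u t)⁻¹ ≤ invBound kl km u₀ v₀ T :=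
  (inv_le_of_exp_le hu₀ hkl ht.2 (hI.u_ge t ht.1)).trans
    (le_add_of_nonneg_right (by positivity))

theorem inv_v_le (hI : Iterate h p₀ K kl km u₀ v₀ p u v) (hu₀ : 0 < u₀) (hv₀ : 0 < v₀)
    (hkm : 0 ≤ km) {T : ℝ} (t : ℝ) (ht : t ∈ Icc 0 T) : (v t)⁻¹ ≤ invBound kl km u₀ v₀ T :=
  (inv_le_of_exp_le hv₀ hkm ht.2 (hI.v_ge t ht.1)).trans
    (le_add_of_nonneg_left (by positivity))

theorem abs_le (hI : Iterate h p₀ K kl km u₀ v₀ p u v) (hu₀ : 0 < u₀) (hv₀ : 0 < v₀)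
    (hK : 0 ≤ K) (hh : ∀ n, 0 ≤ h n) {T : ℝ} (t : ℝ) (ht : t ∈ Icc 0 T) (n : ℤ) :
    |p t n| ≤ h n * Real.exp (4 * K * invBound kl km u₀ v₀ T * T) := by
  rw [abs_of_nonneg (hI.p_nonneg t ht.1 n)]
  refine (hI.p_le T t ht n).trans (mul_le_mul_of_nonneg_left (Real.exp_le_exp.2 ?_) (hh n))
  have : 0 ≤ invBound kl km u₀ v₀ T := by unfold invBound; positivity
  exact mul_le_mul_of_nonneg_left ht.2 (by positivity)

theorem locDom (hI : Iterate h p₀ K kl km u₀ v₀ p u v) (hu₀ : 0 < u₀) (hv₀ : 0 < v₀)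
    (hK : 0 ≤ K) (hh : ∀ n, 0 ≤ h n) (hhw : Summable fun n => h n * w n) : LocDom w p := by
  intro T
  refine ⟨fun n => h n * Real.exp (4 * K * invBound kl km u₀ v₀ T * T),
    fun n => mul_nonneg (hh n) (Real.exp_pos _).le, ?_,
    fun t ht n => hI.abs_le hu₀ hv₀ hK hh t ht n⟩
  exact (hhw.mul_right (Real.exp (4 * K * invBound kl km u₀ v₀ T * T))).congr fun n => by ring

end Iterate

theorem Admissible.K_pos {a b w w' : ℤ → ℝ} {K : ℝ} (hA : Admissible a b w w' K) : 0 < K :=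
  (pos_iff_pos_of_mul_pos (lt_of_lt_of_le one_pos (hA.one_le 0))).2 (hA.weak.w_pos 0)

theorem Admissible.abs_a_le {a b w w' : ℤ → ℝ} {K : ℝ} (hA : Admissible a b w w' K) (n : ℤ) :
    |a n| ≤ K * w' n := by
  rw [abs_of_nonneg (hA.weak.a_nonneg n)]; exact hA.a_le n

theorem Admissible.abs_b_le {a b w w' : ℤ → ℝ} {K : ℝ} (hA : Admissible a b w w' K) (n : ℤ) :
    |b n| ≤ K * w' n := by
  rw [abs_of_nonneg (hA.weak.b_nonneg n)]; exact hA.b_le n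

theorem Admissible.locDom_weak {a b w w' : ℤ → ℝ} {K : ℝ} (hA : Admissible a b w w' K)
    {p : ℝ → ℤ → ℝ} (hp : LocDom w p) : LocDom w' p := by
  intro T
  obtain ⟨H, h0, hs, hH⟩ := hp T
  exact ⟨H, h0, Summable.mul_of_weight_le h0 hs (fun n => (hA.weak.w_pos n).le) hA.weak_le, hH⟩

section Existence

variable {a b w w' h p₀ : ℤ → ℝ} {K c kl km u₀ v₀ : ℝ}

/-- The invariants reproduce themselves. If the input lies below the barrier `h exp (4 K X t)`, then
`gain h ≤ 4 K h` bounds the gain by the derivative of the barrier, so the output lies below it as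
well. Nonnegative gains keep `p ≥ 0`, which gives the lower bounds for `u` and `v`. -/
theorem Iterate.exists_step (hA : Admissible a b w w' K) (hc : 0 ≤ c) (hkl : 0 ≤ kl)
    (hkm : 0 ≤ km) (hu₀ : 0 < u₀) (hv₀ : 0 < v₀) (hp₀ : ∀ n, 0 ≤ p₀ n) (hph : ∀ n, p₀ n ≤ h n)
    (hhw : Summable fun n => h n * w n) (hhg : ∀ n, gain a b h n ≤ 4 * K * h n)
    {p : ℝ → ℤ → ℝ} {u v : ℝ → ℝ} (hI : Iterate h p₀ K kl km u₀ v₀ p u v) :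
    ∃ P U V, Iterate h p₀ K kl km u₀ v₀ P U V ∧ Step a b c kl km p u v P U V := by
  have ha := hA.weak.a_nonneg
  have hb := hA.weak.b_nonneg
  have hh : ∀ n, 0 ≤ h n := fun n => (hp₀ n).trans (hph n)
  have hd := hA.locDom_weak (hI.locDom hu₀ hv₀ hA.K_pos.le hh hhw)
  have hu := hI.cont_u.inv₀ fun s hs => (hI.u_pos hu₀ s hs).ne'
  have hv := hI.cont_v.inv₀ fun s hs => (hI.v_pos hv₀ s hs).ne'
  have hup : ∀ t, 0 ≤ t → 0 ≤ (u t)⁻¹ := fun t ht => (inv_pos.2 (hI.u_pos hu₀ t ht)).le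
  have hvp : ∀ t, 0 ≤ t → 0 ≤ (v t)⁻¹ := fun t ht => (inv_pos.2 (hI.v_pos hv₀ t ht)).le
  have hr : ∀ n, ContinuousOn (fun t => a n * (u t)⁻¹ + b n * (v t)⁻¹) (Ici 0) := fun n =>
    (hu.const_mul (a n)).add (hv.const_mul (b n))
  have hr0 : ∀ n, ∀ t, 0 ≤ t → 0 ≤ a n * (u t)⁻¹ + b n * (v t)⁻¹ := fun n t ht =>
    add_nonneg (mul_nonneg (ha n) (hup t ht)) (mul_nonneg (hb n) (hvp t ht))
  have hf : ∀ n, ContinuousOn (fun t => a (n - 1) * (u t)⁻¹ * p t (n - 1)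
      + b (n + 1) * (v t)⁻¹ * p t (n + 1)) (Ici 0) := fun n =>
    ((hu.const_mul _).mul (hI.cont_p _)).add ((hv.const_mul _).mul (hI.cont_p _))
  have hf0 : ∀ n, ∀ t, 0 ≤ t → 0 ≤ a (n - 1) * (u t)⁻¹ * p t (n - 1)
      + b (n + 1) * (v t)⁻¹ * p t (n + 1) := fun n t ht =>
    add_nonneg (mul_nonneg (mul_nonneg (ha _) (hup t ht)) (hI.p_nonneg t ht _))
      (mul_nonneg (mul_nonneg (hb _) (hvp t ht)) (hI.p_nonneg t ht _))
  choose y hy0 hy using fun n => exists_linear_solution (hr n) (hf n) (p₀ n)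
  obtain ⟨U, hU0, hU⟩ := exists_linear_solution (r := fun _ => kl) continuousOn_const
    ((hd.continuousOn_tsum hI.cont_p hA.abs_a_le).const_mul c) u₀
  obtain ⟨V, hV0, hV⟩ := exists_linear_solution (r := fun _ => km) continuousOn_const
    ((hd.continuousOn_tsum hI.cont_p hA.abs_b_le).const_mul c) v₀
  refine ⟨fun t n => y n t, U, V, ?_, ⟨fun t ht n => hy n t ht, hU, hV⟩⟩
  refine ⟨funext hy0, hU0, hV0, fun n t ht => (hy n t ht).continuousWithinAt,
    fun t ht => (hU t ht).continuousWithinAt, fun t ht => (hV t ht).continuousWithinAt,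
    fun t ht n => ?_, fun T t ht n => ?_, fun t ht => ?_, fun t ht => ?_⟩
  · exact nonneg_of_linear (hr n) (hy n) (fun s hs => hf0 n s hs.1)
      ((hp₀ n).trans_eq (hy0 n).symm) t ⟨ht, le_rfl⟩
  · refine (le_abs_self _).trans (abs_le_exp_of_linear (hh n) (hr n) (fun s hs => hr0 n s hs.1)
      (hy n) (fun s hs => ?_) ?_ t ht)
    · rw [abs_of_nonneg (hf0 n s hs.1)]
      set X := invBound kl km u₀ v₀ T with hX
      set e := Real.exp (4 * K * X * s) with he
      have hX0 : 0 ≤ X := (hup s hs.1).trans (hI.inv_u_le hu₀ hv₀ hkl s hs)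
      have h1 : a (n - 1) * (u s)⁻¹ * p s (n - 1) ≤ a (n - 1) * X * (h (n - 1) * e) :=
        mul_le_mul (mul_le_mul_of_nonneg_left (hI.inv_u_le hu₀ hv₀ hkl s hs) (ha _))
          (hI.p_le T s hs _) (hI.p_nonneg s hs.1 _) (mul_nonneg (ha _) hX0)
      have h2 : b (n + 1) * (v s)⁻¹ * p s (n + 1) ≤ b (n + 1) * X * (h (n + 1) * e) :=
        mul_le_mul (mul_le_mul_of_nonneg_left (hI.inv_v_le hu₀ hv₀ hkm s hs) (hb _))
          (hI.p_le T s hs _) (hI.p_nonneg s hs.1 _) (mul_nonneg (hb _) hX0)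
      have h3 := mul_le_mul_of_nonneg_left (hhg n) (mul_nonneg hX0 (Real.exp_pos (4 * K * X * s)).le)
      rw [← he] at h3
      unfold gain at h3
      linarith
    · rw [hy0, abs_of_nonneg (hp₀ n)]
      exact hph n
  · exact linear_ge_exp hU0 hU (fun s hs => mul_nonneg hc
      (tsum_nonneg fun n => mul_nonneg (hI.p_nonneg s hs n) (ha n))) t ht
  · exact linear_ge_exp hV0 hV (fun s hs => mul_nonneg hc
      (tsum_nonneg fun n => mul_nonneg (hI.p_nonneg s hs n) (hb n))) t ht

theorem iterate_const (hK : 0 ≤ K) (hkl : 0 ≤ kl)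
    (hkm : 0 ≤ km) (hu₀ : 0 < u₀) (hv₀ : 0 < v₀) (hp₀ : ∀ n, 0 ≤ p₀ n) (hph : ∀ n, p₀ n ≤ h n) :
    Iterate h p₀ K kl km u₀ v₀ (fun _ => p₀) (fun _ => u₀) (fun _ => v₀) := by
  refine ⟨rfl, rfl, rfl, fun _ => continuousOn_const, continuousOn_const, continuousOn_const,
    fun _ _ => hp₀, fun T t ht n => ?_, fun t ht => ?_, fun t ht => ?_⟩
  · have : 0 ≤ invBound kl km u₀ v₀ T := by unfold invBound; positivity
    exact (hph n).trans (le_mul_of_one_le_right ((hp₀ n).trans (hph n))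
      (Real.one_le_exp (mul_nonneg (by positivity) ht.1)))
  · exact mul_le_of_le_one_right hu₀.le (Real.exp_le_one_iff.2 (by nlinarith))
  · exact mul_le_of_le_one_right hv₀.le (Real.exp_le_one_iff.2 (by nlinarith))

theorem exists_limit_of_geometric {f : ℕ → ℝ → ℝ} (hf : ∀ k, ContinuousOn (f k) (Ici 0))
    (hB : ∀ T, ∃ C, ∀ t ∈ Icc 0 T, ∀ k, |f k t - f (k + 1) t| ≤ C / 2 / 2 ^ k) :
    ∃ F : ℝ → ℝ, ContinuousOn F (Ici 0) ∧
      ∀ t, 0 ≤ t → Tendsto (fun k => f k t) atTop (𝓝 (F t)) := by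
  have hex : ∀ t, ∃ x, 0 ≤ t → Tendsto (fun k => f k t) atTop (𝓝 x) := by
    intro t
    by_cases ht : 0 ≤ t
    · obtain ⟨C, hC⟩ := hB t
      obtain ⟨x, hx⟩ := cauchySeq_tendsto_of_complete
        (cauchySeq_of_le_geometric_two (f := fun k => f k t) (C := C) (hC t ⟨ht, le_rfl⟩))
      exact ⟨x, fun _ => hx⟩
    · exact ⟨0, fun h => absurd h ht⟩
  choose F hF using hex
  refine ⟨F, continuousOn_Ici_of_Icc fun T => ?_, hF⟩
  obtain ⟨C, hC⟩ := hB T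
  refine TendstoUniformlyOn.continuousOn (F := f) (p := atTop) ?_
    (Frequently.of_forall fun k => (hf k).mono Icc_subset_Ici_self)
  have h0 : Tendsto (fun k : ℕ => C / 2 ^ k) atTop (𝓝 0) := by
    have := (tendsto_pow_atTop_nhds_zero_of_lt_one (r := (1 / 2 : ℝ)) (by norm_num)
      (by norm_num)).const_mul C
    simpa [div_eq_mul_inv] using this
  rw [Metric.tendstoUniformlyOn_iff]
  intro ε hε
  filter_upwards [h0.eventually_lt_const hε] with k hk t ht
  rw [dist_comm]
  exact (dist_le_of_le_geometric_two_of_tendsto (hC t ht) (hF t ht.1) k).trans_lt hk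

/-- The thresholds for `κ` involve `g`, so both are chosen together. Including `0` in the maximum
ensures `exp (κ t) ≥ 1` for `t ≥ 0`. -/
theorem exists_max_rate (hA : Admissible a b w w' K) (h : ℤ → ℝ) (hh : ∀ n, 0 ≤ h n)
    (hhw : Summable fun n => h n * w n) (c X : ℝ) :
    ∃ g κ, DiffMajorant a b h g (4 * K) ∧ 2 * (4 * K * X + X ^ 2) ≤ κ ∧
      2 * (c * ∑' n, g n * a n) ≤ κ ∧ 2 * (c * ∑' n, g n * b n) ≤ κ ∧ 0 ≤ κ := by
  obtain ⟨g, hg⟩ := hA.exists_diffMajorant hh hhw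
  refine ⟨g, max (max (2 * (4 * K * X + X ^ 2)) (2 * (c * ∑' n, g n * a n)))
    (max (2 * (c * ∑' n, g n * b n)) 0), hg, ?_, ?_, ?_, ?_⟩ <;> simp

end Existence

/-! ### Convergence of the iteration to a fixed point -/

section Existence

variable {a b w w' h p₀ : ℤ → ℝ} {K c kl km u₀ v₀ : ℝ}

theorem Iterate.contraction (hA : Admissible a b w w' K) (hc : 0 ≤ c) (hkl : 0 ≤ kl)
    (hkm : 0 ≤ km) (hu₀ : 0 < u₀) (hv₀ : 0 < v₀) (hh : ∀ n, 0 ≤ h n) {T κ ε : ℝ} {g : ℤ → ℝ}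
    (hg : DiffMajorant a b
      (fun n => h n * Real.exp (4 * K * invBound kl km u₀ v₀ T * T)) g (4 * K))
    (hκ : 2 * (4 * K * invBound kl km u₀ v₀ T + invBound kl km u₀ v₀ T ^ 2) ≤ κ)
    (hκa : 2 * (c * ∑' n, g n * a n) ≤ κ) (hκb : 2 * (c * ∑' n, g n * b n) ≤ κ) (hε : 0 ≤ ε)
    {p q P Q : ℝ → ℤ → ℝ} {u v u' v' U V U' V' : ℝ → ℝ}
    (hp : Iterate h p₀ K kl km u₀ v₀ p u v) (hq : Iterate h p₀ K kl km u₀ v₀ q u' v')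
    (hP : Iterate h p₀ K kl km u₀ v₀ P U V) (hQ : Iterate h p₀ K kl km u₀ v₀ Q U' V')
    (h₁ : Step a b c kl km p u v P U V) (h₂ : Step a b c kl km q u' v' Q U' V')
    (hcl : Close T κ ε g p u v q u' v') : Close T κ (ε / 2) g P U V Q U' V' :=
  Step.contraction hA.weak.a_nonneg hA.weak.b_nonneg hc hkl hkm h₁ h₂
    (hP.init_p.trans hQ.init_p.symm) (hP.init_u.trans hQ.init_u.symm)
    (hP.init_v.trans hQ.init_v.symm) hp.cont_u hp.cont_v (hp.u_pos hu₀) (hp.v_pos hv₀)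
    (hq.u_pos hu₀) (hq.v_pos hv₀) (hp.inv_u_le hu₀ hv₀ hkl) (hp.inv_v_le hu₀ hv₀ hkm)
    (hq.inv_u_le hu₀ hv₀ hkl) (hq.inv_v_le hu₀ hv₀ hkm) hg
    (hq.abs_le hu₀ hv₀ hA.K_pos.le hh) (hQ.abs_le hu₀ hv₀ hA.K_pos.le hh) hκ hκa hκb hε hcl

theorem Iterate.exists_close (hK : 0 ≤ K) (hu₀ : 0 < u₀) (hv₀ : 0 < v₀) (hh : ∀ n, 0 ≤ h n)
    {T κ : ℝ} (hκ : 0 ≤ κ) {g : ℤ → ℝ}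
    (hg : ∀ n, h n * Real.exp (4 * K * invBound kl km u₀ v₀ T * T) ≤ g n)
    {p q : ℝ → ℤ → ℝ} {u v u' v' : ℝ → ℝ}
    (hp : Iterate h p₀ K kl km u₀ v₀ p u v) (hq : Iterate h p₀ K kl km u₀ v₀ q u' v') :
    ∃ ε, 0 ≤ ε ∧ Close T κ ε g p u v q u' v' := by
  obtain ⟨Cu, hCu⟩ := isCompact_Icc.exists_bound_of_continuousOn
    ((hp.cont_u.sub hq.cont_u).mono (Icc_subset_Ici_self : Icc 0 T ⊆ Ici 0))
  obtain ⟨Cv, hCv⟩ := isCompact_Icc.exists_bound_of_continuousOn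
    ((hp.cont_v.sub hq.cont_v).mono (Icc_subset_Ici_self : Icc 0 T ⊆ Ici 0))
  -- The `2` serves the sequences, each of which is at most `g`; compactness of `[0, T]` serves the
  -- scalars.
  refine ⟨max 2 (max Cu Cv), by positivity, fun t ht => ?_⟩
  have he : 1 ≤ Real.exp (κ * t) := Real.one_le_exp (mul_nonneg hκ ht.1)
  have hm : max 2 (max Cu Cv) ≤ max 2 (max Cu Cv) * Real.exp (κ * t) :=
    le_mul_of_one_le_right (by positivity) he
  refine ⟨fun n => ?_, ?_, ?_⟩
  · have hg0 : 0 ≤ g n := (mul_nonneg (hh n) (Real.exp_pos _).le).trans (hg n)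
    have h1 := (hp.abs_le hu₀ hv₀ hK hh t ht n).trans (hg n)
    have h2 := (hq.abs_le hu₀ hv₀ hK hh t ht n).trans (hg n)
    calc |p t n - q t n| ≤ |p t n| + |q t n| := abs_sub _ _
      _ ≤ 2 * g n := by linarith
      _ ≤ _ := mul_le_mul_of_nonneg_right ((le_max_left _ _).trans hm) hg0
  · exact (hCu t ht).trans (((le_max_left _ _).trans (le_max_right _ _)).trans hm)
  · exact (hCv t ht).trans (((le_max_right _ _).trans (le_max_right _ _)).trans hm)

theorem Iterate.of_tendsto {p : ℕ → ℝ → ℤ → ℝ} {u v : ℕ → ℝ → ℝ} {q : ℝ → ℤ → ℝ} {x y : ℝ → ℝ}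
    (hz : ∀ k, Iterate h p₀ K kl km u₀ v₀ (p k) (u k) (v k))
    (hq : ∀ n, ContinuousOn (fun t => q t n) (Ici 0)) (hx : ContinuousOn x (Ici 0))
    (hy : ContinuousOn y (Ici 0))
    (hp_lim : ∀ n t, 0 ≤ t → Tendsto (fun k => p k t n) atTop (𝓝 (q t n)))
    (hu_lim : ∀ t, 0 ≤ t → Tendsto (fun k => u k t) atTop (𝓝 (x t)))
    (hv_lim : ∀ t, 0 ≤ t → Tendsto (fun k => v k t) atTop (𝓝 (y t))) :
    Iterate h p₀ K kl km u₀ v₀ q x y where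
  init_p := by
    funext n
    refine tendsto_nhds_unique (hp_lim n 0 le_rfl) ?_
    simp only [(hz _).init_p, tendsto_const_nhds]
  init_u := by
    refine tendsto_nhds_unique (hu_lim 0 le_rfl) ?_
    simp only [(hz _).init_u, tendsto_const_nhds]
  init_v := by
    refine tendsto_nhds_unique (hv_lim 0 le_rfl) ?_
    simp only [(hz _).init_v, tendsto_const_nhds]
  cont_p := hq
  cont_u := hx
  cont_v := hy
  p_nonneg t ht n := ge_of_tendsto' (hp_lim n t ht) fun k => (hz k).p_nonneg t ht n
  p_le T t ht n := le_of_tendsto' (hp_lim n t ht.1) fun k => (hz k).p_le T t ht n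
  u_ge t ht := ge_of_tendsto' (hu_lim t ht) fun k => (hz k).u_ge t ht
  v_ge t ht := ge_of_tendsto' (hv_lim t ht) fun k => (hz k).v_ge t ht

theorem exists_iterate_fixed (hA : Admissible a b w w' K) (hc : 0 ≤ c) (hkl : 0 ≤ kl)
    (hkm : 0 ≤ km) (hu₀ : 0 < u₀) (hv₀ : 0 < v₀) (hp₀ : ∀ n, 0 ≤ p₀ n) (hph : ∀ n, p₀ n ≤ h n)
    (hhw : Summable fun n => h n * w n) (hhg : ∀ n, gain a b h n ≤ 4 * K * h n) :
    ∃ p u v, Iterate h p₀ K kl km u₀ v₀ p u v ∧ Step a b c kl km p u v p u v := by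
  have hK := hA.K_pos.le
  have hh : ∀ n, 0 ≤ h n := fun n => (hp₀ n).trans (hph n)
  have hseq : ∃ (p : ℕ → ℝ → ℤ → ℝ) (u v : ℕ → ℝ → ℝ),
      (∀ k, Iterate h p₀ K kl km u₀ v₀ (p k) (u k) (v k)) ∧
      ∀ k, Step a b c kl km (p k) (u k) (v k) (p (k + 1)) (u (k + 1)) (v (k + 1)) := by
    let S := {z : (ℝ → ℤ → ℝ) × (ℝ → ℝ) × (ℝ → ℝ) //
      Iterate h p₀ K kl km u₀ v₀ z.1 z.2.1 z.2.2}
    have hstep : ∀ z : S, ∃ z' : S,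
        Step a b c kl km z.1.1 z.1.2.1 z.1.2.2 z'.1.1 z'.1.2.1 z'.1.2.2 := by
      intro z
      obtain ⟨P, U, V, hI, hS⟩ := z.2.exists_step hA hc hkl hkm hu₀ hv₀ hp₀ hph hhw hhg
      exact ⟨⟨(P, U, V), hI⟩, hS⟩
    choose F hF using hstep
    let z₀ : S := ⟨(fun _ => p₀, fun _ => u₀, fun _ => v₀),
      iterate_const hK hkl hkm hu₀ hv₀ hp₀ hph⟩
    refine ⟨fun k => (F^[k] z₀).1.1, fun k => (F^[k] z₀).1.2.1, fun k => (F^[k] z₀).1.2.2,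
      fun k => (F^[k] z₀).2, fun k => ?_⟩
    simp only [Function.iterate_succ_apply']
    exact hF _
  obtain ⟨p, u, v, hI, hS⟩ := hseq
  -- The majorant and the constants depend on `T`, but the iteration does not, so its pointwise
  -- limits are defined on all of `[0, ∞)`.
  have hT : ∀ T, ∃ g κ ε, 0 ≤ ε ∧ DiffMajorant a b
      (fun n => h n * Real.exp (4 * K * invBound kl km u₀ v₀ T * T)) g (4 * K) ∧
      2 * (4 * K * invBound kl km u₀ v₀ T + invBound kl km u₀ v₀ T ^ 2) ≤ κ ∧
      2 * (c * ∑' n, g n * a n) ≤ κ ∧ 2 * (c * ∑' n, g n * b n) ≤ κ ∧ 0 ≤ κ ∧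
      ∀ k, Close T κ (ε / 2 ^ k) g (p k) (u k) (v k) (p (k + 1)) (u (k + 1)) (v (k + 1)) := by
    intro T
    obtain ⟨g, κ, hg, hκ, hκa, hκb, hκ0⟩ := exists_max_rate hA
      (fun n => h n * Real.exp (4 * K * invBound kl km u₀ v₀ T * T))
      (fun n => mul_nonneg (hh n) (Real.exp_pos _).le)
      ((hhw.mul_right (Real.exp (4 * K * invBound kl km u₀ v₀ T * T))).congr fun n => by ring)
      c (invBound kl km u₀ v₀ T)
    obtain ⟨ε, hε, hcl⟩ := Iterate.exists_close hK hu₀ hv₀ hh hκ0 hg.H_le (hI 0) (hI 1)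
    refine ⟨g, κ, ε, hε, hg, hκ, hκa, hκb, hκ0, fun k => ?_⟩
    induction k with
    | zero => simpa using hcl
    | succ k ih =>
      have := Iterate.contraction hA hc hkl hkm hu₀ hv₀ hh hg hκ hκa hκb (by positivity)
        (hI k) (hI (k + 1)) (hI (k + 1)) (hI (k + 2)) (hS k) (hS (k + 1)) ih
      rwa [div_div, ← pow_succ] at this
  choose g κ ε hε hg hκ hκa hκb hκ0 hcl using hT
  have hg0 : ∀ T n, 0 ≤ g T n := fun T n => ((hg T).H_nonneg n).trans ((hg T).H_le n)
  have hexp : ∀ T, ∀ t ∈ Icc 0 T, Real.exp (κ T * t) ≤ Real.exp (κ T * T) := fun T t ht =>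
    Real.exp_le_exp.2 (mul_le_mul_of_nonneg_left ht.2 (hκ0 T))
  have hgeo : ∀ {s e E : ℝ} (k : ℕ), 0 ≤ s → e ≤ E → s / 2 ^ k * e ≤ 2 * s * E / 2 / 2 ^ k := by
    intro s e E k hs he
    have := mul_le_mul_of_nonneg_left he (show 0 ≤ s / 2 ^ k by positivity)
    refine this.trans_eq (by ring)
  have hlp : ∀ n, ∃ F : ℝ → ℝ, ContinuousOn F (Ici 0) ∧
      ∀ t, 0 ≤ t → Tendsto (fun k => p k t n) atTop (𝓝 (F t)) := fun n =>
    exists_limit_of_geometric (fun k => (hI k).cont_p n) fun T =>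
      ⟨2 * ε T * (Real.exp (κ T * T) * g T n), fun t ht k => by
        refine ((hcl T k t ht).1 n).trans ?_
        rw [mul_assoc]
        exact hgeo k (hε T) (mul_le_mul_of_nonneg_right (hexp T t ht) (hg0 T n))⟩
  obtain ⟨x, hxc, hx⟩ := exists_limit_of_geometric (fun k => (hI k).cont_u) fun T =>
    ⟨2 * ε T * Real.exp (κ T * T), fun t ht k =>
      (hcl T k t ht).2.1.trans (hgeo k (hε T) (hexp T t ht))⟩
  obtain ⟨y, hyc, hy⟩ := exists_limit_of_geometric (fun k => (hI k).cont_v) fun T =>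
    ⟨2 * ε T * Real.exp (κ T * T), fun t ht k =>
      (hcl T k t ht).2.2.trans (hgeo k (hε T) (hexp T t ht))⟩
  choose q hqc hq using hlp
  have hIq : Iterate h p₀ K kl km u₀ v₀ (fun t n => q n t) x y :=
    Iterate.of_tendsto hI hqc hxc hyc hq hx hy
  -- Instead of passing to the limit in the equations, apply one more step to the limit `(q, x, y)`.
  -- By contraction the iterates also converge to the output `(P, U, V)`, so the limit is a fixed
  -- point.
  obtain ⟨P, U, V, hIP, hSP⟩ := hIq.exists_step hA hc hkl hkm hu₀ hv₀ hp₀ hph hhw hhg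
  -- The factor `2` is the sum of the geometric tail.
  have hlim : ∀ T k, Close T (κ T) (2 * ε T / 2 ^ k) (g T) (p k) (u k) (v k)
      (fun t n => q n t) x y := by
    intro T k t ht
    have hd : ∀ {f : ℕ → ℝ} {l D : ℝ}, Tendsto f atTop (𝓝 l) →
        (∀ k, |f k - f (k + 1)| ≤ ε T / 2 ^ k * D) → |f k - l| ≤ 2 * ε T / 2 ^ k * D := by
      intro f l D hf hD
      have := dist_le_of_le_geometric_two_of_tendsto (f := f) (C := 2 * ε T * D)
        (fun k => (hD k).trans_eq (by ring)) hf k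
      exact this.trans_eq (by ring)
    refine ⟨fun n => ?_, hd (hx t ht.1) fun k => (hcl T k t ht).2.1,
      hd (hy t ht.1) fun k => (hcl T k t ht).2.2⟩
    rw [mul_assoc]
    exact hd (f := fun k => p k t n) (hq n t ht.1)
      fun k => ((hcl T k t ht).1 n).trans_eq (mul_assoc _ _ _)
  have hnext : ∀ T k, Close T (κ T) (2 * ε T / 2 ^ k / 2) (g T) (p (k + 1)) (u (k + 1))
      (v (k + 1)) P U V := fun T k =>
    Iterate.contraction hA hc hkl hkm hu₀ hv₀ hh (hg T) (hκ T) (hκa T) (hκb T)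
      (by have := hε T; positivity) (hI k) hIq (hI (k + 1)) hIP (hS k) hSP (hlim T k)
  have hsmall : ∀ T D, Tendsto (fun k : ℕ => 2 * ε T / 2 ^ k / 2 * D) atTop (𝓝 0) := by
    intro T D
    have := (tendsto_pow_atTop_nhds_zero_of_lt_one (r := (1 / 2 : ℝ)) (by norm_num)
      (by norm_num)).const_mul (ε T * D)
    rw [mul_zero] at this
    refine this.congr fun k => ?_
    rw [one_div, inv_pow]
    ring
  have huniq : ∀ {f : ℕ → ℝ} {l l' T D : ℝ}, Tendsto f atTop (𝓝 l) →
      (∀ k, |f (k + 1) - l'| ≤ 2 * ε T / 2 ^ k / 2 * D) → l = l' := by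
    intro f l l' T D hf hD
    refine tendsto_nhds_unique ((tendsto_add_atTop_iff_nat 1).2 hf) ?_
    rw [tendsto_iff_norm_sub_tendsto_zero]
    exact squeeze_zero (fun k => norm_nonneg _) hD (hsmall T D)
  have hqP : ∀ t, 0 ≤ t → ∀ n, q n t = P t n := fun t ht n =>
    huniq (T := t) (D := Real.exp (κ t * t) * g t n) (hq n t ht)
      fun k => ((hnext t k t ⟨ht, le_rfl⟩).1 n).trans_eq (mul_assoc _ _ _)
  have hxU : ∀ t, 0 ≤ t → x t = U t := fun t ht =>
    huniq (hx t ht) fun k => (hnext t k t ⟨ht, le_rfl⟩).2.1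
  have hyV : ∀ t, 0 ≤ t → y t = V t := fun t ht =>
    huniq (hy t ht) fun k => (hnext t k t ⟨ht, le_rfl⟩).2.2
  refine ⟨fun t n => q n t, x, y, hIq, fun t ht n => ?_, fun t ht => ?_, fun t ht => ?_⟩
  · have := hSP.eq_p t ht n
    rw [← hqP t ht n] at this
    exact this.congr (fun s hs => hqP s hs n) (hqP t ht n)
  · have := hSP.eq_u t ht
    rw [← hxU t ht] at this
    exact this.congr hxU (hxU t ht)
  · have := hSP.eq_v t ht
    rw [← hyV t ht] at this
    exact this.congr hyV (hyV t ht)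

end Existence

/-! ### Differentiation of linear functionals of dominated families -/

/-- For `t > 0` domination of `d` permits termwise differentiation on an open interval. At `t = 0`
the one-sided derivative is the limit of the derivatives from the right. -/
theorem LocDom.hasDerivWithinAt_tsum {w φ : ℤ → ℝ} {p d : ℝ → ℤ → ℝ} {K : ℝ} (hp : LocDom w p)
    (hd : LocDom w d) (hφ : ∀ n, |φ n| ≤ K * w n)
    (hpd : ∀ t, 0 ≤ t → ∀ n, HasDerivWithinAt (fun s => p s n) (d t n) (Ici 0) t)
    (hdc : ∀ n, ContinuousOn (fun t => d t n) (Ici 0)) {t : ℝ} (ht : 0 ≤ t) :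
    HasDerivWithinAt (fun s => ∑' n, p s n * φ n) (∑' n, d t n * φ n) (Ici 0) t := by
  have hpos : ∀ s, 0 < s → HasDerivAt (fun s => ∑' n, p s n * φ n) (∑' n, d s n * φ n) s := by
    intro s hs
    obtain ⟨H, -, hHs, hH⟩ := hd (s + 1)
    refine hasDerivAt_tsum_of_isPreconnected (t := Ioo 0 (s + 1)) (y₀ := s)
      (g := fun n s => p s n * φ n) (g' := fun n s => d s n * φ n) (hHs.mul_left K)
      isOpen_Ioo isPreconnected_Ioo (fun n y hy => ?_) (fun n y hy => ?_)
      ⟨hs, by linarith⟩ (hp.summable hφ hs.le) ⟨hs, by linarith⟩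
    · exact ((hpd y hy.1.le n).hasDerivAt (Ici_mem_nhds hy.1)).mul_const (φ n)
    · exact norm_mul_le_of_weight (hH y (Ioo_subset_Icc_self hy) n) (hφ n)
  rcases ht.eq_or_lt with rfl | ht
  · have hpc : ∀ n, ContinuousOn (fun t => p t n) (Ici 0) := fun n t ht =>
      (hpd t ht n).continuousWithinAt
    refine hasDerivWithinAt_Ici_of_tendsto_deriv (s := Ioi 0)
      (fun s hs => (hpos s hs).differentiableAt.differentiableWithinAt)
      (((hp.continuousOn_tsum hpc hφ) 0 self_mem_Ici).mono Ioi_subset_Ici_self)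
      self_mem_nhdsWithin ?_
    refine Tendsto.congr' ?_
      ((((hd.continuousOn_tsum hdc hφ) 0 self_mem_Ici).mono Ioi_subset_Ici_self).tendsto)
    filter_upwards [self_mem_nhdsWithin] with s hs
    exact (hpos s hs).deriv.symm
  · exact (hpos t ht).hasDerivWithinAt

theorem contDiffOn_two_of_hasDerivWithinAt {f f' f'' : ℝ → ℝ}
    (h1 : ∀ t, 0 ≤ t → HasDerivWithinAt f (f' t) (Ici 0) t)
    (h2 : ∀ t, 0 ≤ t → HasDerivWithinAt f' (f'' t) (Ici 0) t)
    (h3 : ContinuousOn f'' (Ici 0)) : ContDiffOn ℝ 2 f (Ici 0) := by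
  have hsucc : ∀ {n : ℕ} {g g' : ℝ → ℝ}, (∀ t, 0 ≤ t → HasDerivWithinAt g (g' t) (Ici 0) t) →
      ContDiffOn ℝ n g' (Ici 0) → ContDiffOn ℝ (n + 1) g (Ici 0) := by
    intro n g g' hg hg'
    rw [contDiffOn_succ_iff_derivWithin (uniqueDiffOn_Ici 0)]
    refine ⟨fun t ht => (hg t ht).differentiableWithinAt, by simp, hg'.congr fun t ht => ?_⟩
    exact (hg t ht).derivWithin (uniqueDiffOn_Ici 0 t ht)
  have h4 : ContDiffOn ℝ ((0 : ℕ) + 1 : ℕ) f' (Ici 0) := by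
    have := hsucc (n := 0) h2 (by simpa using h3)
    exact_mod_cast this
  have h5 := hsucc h1 h4
  norm_num at h5
  exact h5

theorem eq_of_hasDerivWithinAt_zero {f : ℝ → ℝ}
    (h : ∀ t, 0 ≤ t → HasDerivWithinAt f 0 (Ici 0) t) {t : ℝ} (ht : 0 ≤ t) : f t = f 0 :=
  constant_of_has_deriv_right_zero (a := 0) (b := t)
    (fun s hs => ((h s hs.1).continuousWithinAt).mono Icc_subset_Ici_self)
    (fun s hs => (h s hs.1).mono (Ici_subset_Ici.2 hs.1)) t ⟨ht, le_rfl⟩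

theorem monotoneOn_Ici_of_hasDerivWithinAt {f f' : ℝ → ℝ}
    (h : ∀ t, 0 ≤ t → HasDerivWithinAt f (f' t) (Ici 0) t) (h0 : ∀ t, 0 ≤ t → 0 ≤ f' t) :
    MonotoneOn f (Ici 0) := by
  refine monotoneOn_of_hasDerivWithinAt_nonneg (convex_Ici 0)
    (fun t ht => (h t ht).continuousWithinAt) (f' := f') (fun t ht => ?_) fun t ht => ?_
  · exact (h t (interior_subset ht)).mono interior_subset
  · exact h0 t (interior_subset ht)

/-! ### Dominated solutions -/

/-- A solution of the system in the variables `(p, u, v)` that is locally dominated in `ℓ¹(w)`. -/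
structure DomSolution (a b w : ℤ → ℝ) (c kl km : ℝ) (p : ℝ → ℤ → ℝ) (u v : ℝ → ℝ) : Prop where
  step : Step a b c kl km p u v p u v
  dom : LocDom w p
  u_pos : ∀ t, 0 ≤ t → 0 < u t
  v_pos : ∀ t, 0 ≤ t → 0 < v t

/-- The right-hand side of the equation for `p`. -/
noncomputable def drift (a b : ℤ → ℝ) (p : ℝ → ℤ → ℝ) (u v : ℝ → ℝ) (t : ℝ) (n : ℤ) : ℝ :=
  -(a n * (u t)⁻¹ + b n * (v t)⁻¹) * p t n
    + (a (n - 1) * (u t)⁻¹ * p t (n - 1) + b (n + 1) * (v t)⁻¹ * p t (n + 1))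

namespace DomSolution

variable {a b w w' : ℤ → ℝ} {K c kl km : ℝ} {p q : ℝ → ℤ → ℝ} {u v u' v' : ℝ → ℝ}

theorem cont_p (h : DomSolution a b w c kl km p u v) (n : ℤ) :
    ContinuousOn (fun t => p t n) (Ici 0) := fun t ht => (h.step.eq_p t ht n).continuousWithinAt

theorem cont_u (h : DomSolution a b w c kl km p u v) : ContinuousOn u (Ici 0) :=
  fun t ht => (h.step.eq_u t ht).continuousWithinAt

theorem cont_v (h : DomSolution a b w c kl km p u v) : ContinuousOn v (Ici 0) :=
  fun t ht => (h.step.eq_v t ht).continuousWithinAt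

theorem cont_inv_u (h : DomSolution a b w c kl km p u v) :
    ContinuousOn (fun t => (u t)⁻¹) (Ici 0) :=
  h.cont_u.inv₀ fun s hs => (h.u_pos s hs).ne'

theorem cont_inv_v (h : DomSolution a b w c kl km p u v) :
    ContinuousOn (fun t => (v t)⁻¹) (Ici 0) :=
  h.cont_v.inv₀ fun s hs => (h.v_pos s hs).ne'

theorem exists_inv_le (h : DomSolution a b w c kl km p u v) (T : ℝ) :
    ∃ X, 0 ≤ X ∧ (∀ t ∈ Icc 0 T, (u t)⁻¹ ≤ X) ∧ ∀ t ∈ Icc 0 T, (v t)⁻¹ ≤ X := by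
  obtain ⟨X, hX⟩ := isCompact_Icc.exists_bound_of_continuousOn
    (h.cont_inv_u.mono (Icc_subset_Ici_self : Icc 0 T ⊆ Ici 0))
  obtain ⟨Y, hY⟩ := isCompact_Icc.exists_bound_of_continuousOn
    (h.cont_inv_v.mono (Icc_subset_Ici_self : Icc 0 T ⊆ Ici 0))
  exact ⟨max 0 (max X Y), le_max_left _ _,
    fun t ht => (Real.le_norm_self _).trans
      ((hX t ht).trans ((le_max_left _ _).trans (le_max_right _ _))),
    fun t ht => (Real.le_norm_self _).trans
      ((hY t ht).trans ((le_max_right _ _).trans (le_max_right _ _)))⟩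

theorem cont_drift (h : DomSolution a b w c kl km p u v) (n : ℤ) :
    ContinuousOn (fun t => drift a b p u v t n) (Ici 0) := by
  have hu := h.cont_inv_u
  have hv := h.cont_inv_v
  exact (((hu.const_mul _).add (hv.const_mul _)).neg.mul (h.cont_p n)).add
    (((hu.const_mul _).mul (h.cont_p _)).add ((hv.const_mul _).mul (h.cont_p _)))

theorem locDom_drift (hA : Admissible a b w w' K) (h : DomSolution a b w c kl km p u v) :
    LocDom w' (drift a b p u v) := by
  intro T
  obtain ⟨H, h0, hs, hH⟩ := h.dom T
  obtain ⟨X, hX, hu, hv⟩ := h.exists_inv_le T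
  have ha := hA.weak.a_nonneg
  have hb := hA.weak.b_nonneg
  refine ⟨fun n => X * ((a n + b n) * H n + gain a b H n), fun n => ?_, ?_, fun t ht n => ?_⟩
  · exact mul_nonneg hX (add_nonneg (mul_nonneg (add_nonneg (ha n) (hb n)) (h0 n))
      (gain_nonneg ha hb h0 n))
  · exact ((hA.summable_rate h0 hs).mul_left X).congr fun n => by ring
  · have key : ∀ {r y : ℝ} {m : ℤ}, 0 ≤ r → 0 ≤ y → y ≤ X → |r * y * p t m| ≤ r * X * H m := by
      intro r y m hr hy hyX
      rw [abs_mul, abs_of_nonneg (mul_nonneg hr hy)]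
      exact mul_le_mul (mul_le_mul_of_nonneg_left hyX hr) (hH t ht m) (abs_nonneg _)
        (mul_nonneg hr hX)
    have hu0 := (inv_pos.2 (h.u_pos t ht.1)).le
    have hv0 := (inv_pos.2 (h.v_pos t ht.1)).le
    have k1 := abs_le.1 (key (m := n) (ha n) hu0 (hu t ht))
    have k2 := abs_le.1 (key (m := n) (hb n) hv0 (hv t ht))
    have k3 := abs_le.1 (key (m := n - 1) (ha (n - 1)) hu0 (hu t ht))
    have k4 := abs_le.1 (key (m := n + 1) (hb (n + 1)) hv0 (hv t ht))
    unfold drift gain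
    rw [abs_le]
    constructor <;> linarith [k1.1, k1.2, k2.1, k2.2, k3.1, k3.2, k4.1, k4.2]

theorem hasDerivWithinAt_tsum (hA : Admissible a b w w' K)
    (h : DomSolution a b w c kl km p u v) {φ : ℤ → ℝ} (hφ : ∀ n, |φ n| ≤ K * w' n) {t : ℝ}
    (ht : 0 ≤ t) : HasDerivWithinAt (fun s => ∑' n, p s n * φ n)
      (∑' n, drift a b p u v t n * φ n) (Ici 0) t :=
  (hA.locDom_weak h.dom).hasDerivWithinAt_tsum (h.locDom_drift hA) hφ h.step.eq_p h.cont_drift ht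

/-- The derivative of `u` contains `p` only through `∑ p a`. Since `a` is bounded by `w'` and the
drift is dominated in `ℓ¹(w')`, this sum is again continuously differentiable. -/
theorem contDiffOn_u (hA : Admissible a b w w' K) (h : DomSolution a b w c kl km p u v) :
    ContDiffOn ℝ 2 u (Ici 0) := by
  have hφ := hA.abs_a_le
  refine contDiffOn_two_of_hasDerivWithinAt h.step.eq_u
    (fun t ht => ((h.step.eq_u t ht).const_mul (-kl)).add
      ((h.hasDerivWithinAt_tsum hA hφ ht).const_mul c)) ?_
  exact (((h.cont_u.const_mul (-kl)).add (((hA.locDom_weak h.dom).continuousOn_tsum h.cont_p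
    hφ).const_mul c)).const_mul (-kl)).add
    (((h.locDom_drift hA).continuousOn_tsum h.cont_drift hφ).const_mul c)

theorem contDiffOn_v (hA : Admissible a b w w' K) (h : DomSolution a b w c kl km p u v) :
    ContDiffOn ℝ 2 v (Ici 0) := by
  have hφ := hA.abs_b_le
  refine contDiffOn_two_of_hasDerivWithinAt h.step.eq_v
    (fun t ht => ((h.step.eq_v t ht).const_mul (-km)).add
      ((h.hasDerivWithinAt_tsum hA hφ ht).const_mul c)) ?_
  exact (((h.cont_v.const_mul (-km)).add (((hA.locDom_weak h.dom).continuousOn_tsum h.cont_p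
    hφ).const_mul c)).const_mul (-km)).add
    (((h.locDom_drift hA).continuousOn_tsum h.cont_drift hφ).const_mul c)

/-- The drift is a sum of differences between summable fluxes and their shifts, so its total
vanishes. Differentiating the total mass uses that constants are bounded by `K w'`. -/
theorem hasSum_eq (hA : Admissible a b w w' K) (h : DomSolution a b w c kl km p u v) {t m : ℝ}
    (ht : 0 ≤ t) (h0 : HasSum (p 0) m) : HasSum (p t) m := by
  have hφ : ∀ n : ℤ, |(fun _ : ℤ => (1 : ℝ)) n| ≤ K * w' n := fun n => by simpa using hA.one_le n
  have hz : ∀ s, 0 ≤ s → ∑' n, drift a b p u v s n * 1 = 0 := by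
    intro s hs
    have h1 := ((hA.locDom_weak h.dom).summable hA.abs_a_le hs).mul_left (u s)⁻¹
    have h2 := ((hA.locDom_weak h.dom).summable hA.abs_b_le hs).mul_left (v s)⁻¹
    have h1' := GainBound.summable_shift h1 (-1)
    have h2' := GainBound.summable_shift h2 1
    have e : ∀ n, drift a b p u v s n * 1 =
        ((u s)⁻¹ * (p s (n + -1) * a (n + -1)) - (u s)⁻¹ * (p s n * a n)) +
        ((v s)⁻¹ * (p s (n + 1) * b (n + 1)) - (v s)⁻¹ * (p s n * b n)) := by
      intro n
      rw [drift, ← sub_eq_add_neg]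
      ring
    rw [tsum_congr e, (h1'.sub h1).tsum_add (h2'.sub h2), h1'.tsum_sub h1, h2'.tsum_sub h2,
      GainBound.tsum_shift (fun n => (u s)⁻¹ * (p s n * a n)),
      GainBound.tsum_shift (fun n => (v s)⁻¹ * (p s n * b n))]
    ring
  have hc := eq_of_hasDerivWithinAt_zero (f := fun s => ∑' n, p s n * 1)
    (fun s hs => (h.hasDerivWithinAt_tsum hA hφ hs).congr_deriv (hz s hs)) ht
  have hs := (hA.locDom_weak h.dom).summable hφ ht
  simp only [mul_one] at hc hs
  rw [h0.tsum_eq] at hc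
  exact hc ▸ hs.hasSum

/-- Each solution is its own next iterate, so the contraction can be applied repeatedly to the same
pair: the distance is at most `ε / 2 ^ k` for every `k`. -/
theorem unique (hA : Admissible a b w w' K) (hc : 0 ≤ c) (hkl : 0 ≤ kl) (hkm : 0 ≤ km)
    (h₁ : DomSolution a b w c kl km p u v) (h₂ : DomSolution a b w c kl km q u' v')
    (hp0 : p 0 = q 0) (hu0 : u 0 = u' 0) (hv0 : v 0 = v' 0) {t : ℝ} (ht : 0 ≤ t) :
    p t = q t ∧ u t = u' t ∧ v t = v' t := by
  obtain ⟨H₁, h10, h1s, h1H⟩ := h₁.dom t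
  obtain ⟨H₂, h20, h2s, h2H⟩ := h₂.dom t
  obtain ⟨X₁, hX1, hu1, hv1⟩ := h₁.exists_inv_le t
  obtain ⟨X₂, hX2, hu2, hv2⟩ := h₂.exists_inv_le t
  obtain ⟨g, κ, hg, hκ, hκa, hκb, hκ0⟩ := exists_max_rate hA (fun n => H₁ n + H₂ n)
    (fun n => add_nonneg (h10 n) (h20 n)) ((h1s.add h2s).congr fun n => by ring) c (X₁ + X₂)
  have hg0 : ∀ n, 0 ≤ g n := fun n => (hg.H_nonneg n).trans (hg.H_le n)
  obtain ⟨Cu, hCu⟩ := isCompact_Icc.exists_bound_of_continuousOn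
    ((h₁.cont_u.sub h₂.cont_u).mono (Icc_subset_Ici_self : Icc 0 t ⊆ Ici 0))
  obtain ⟨Cv, hCv⟩ := isCompact_Icc.exists_bound_of_continuousOn
    ((h₁.cont_v.sub h₂.cont_v).mono (Icc_subset_Ici_self : Icc 0 t ⊆ Ici 0))
  set ε := max 1 (max Cu Cv) with hε
  have hε0 : 0 ≤ ε := zero_le_one.trans (le_max_left _ _)
  have hcl : ∀ k : ℕ, Close t κ (ε / 2 ^ k) g p u v q u' v' := by
    intro k
    induction k with
    | zero =>
      intro s hs
      have hm : ε ≤ ε * Real.exp (κ * s) :=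
        le_mul_of_one_le_right hε0 (Real.one_le_exp (mul_nonneg hκ0 hs.1))
      rw [pow_zero, div_one]
      refine ⟨fun n => ?_, ?_, ?_⟩
      · calc |p s n - q s n| ≤ |p s n| + |q s n| := abs_sub _ _
          _ ≤ H₁ n + H₂ n := add_le_add (h1H s hs n) (h2H s hs n)
          _ ≤ 1 * g n := by simpa using hg.H_le n
          _ ≤ _ := mul_le_mul_of_nonneg_right ((le_max_left _ _).trans hm) (hg0 n)
      · exact (hCu s hs).trans (((le_max_left _ _).trans (le_max_right _ _)).trans hm)
      · exact (hCv s hs).trans (((le_max_right _ _).trans (le_max_right _ _)).trans hm)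
    | succ k ih =>
      have hqH : ∀ s ∈ Icc 0 t, ∀ n, |q s n| ≤ H₁ n + H₂ n := fun s hs n =>
        (h2H s hs n).trans (le_add_of_nonneg_left (h10 n))
      have := Step.contraction hA.weak.a_nonneg hA.weak.b_nonneg hc hkl hkm h₁.step h₂.step
        hp0 hu0 hv0 h₁.cont_u h₁.cont_v h₁.u_pos h₁.v_pos h₂.u_pos h₂.v_pos
        (X := X₁ + X₂)
        (fun s hs => (hu1 s hs).trans (le_add_of_nonneg_right hX2))
        (fun s hs => (hv1 s hs).trans (le_add_of_nonneg_right hX2))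
        (fun s hs => (hu2 s hs).trans (le_add_of_nonneg_left hX1))
        (fun s hs => (hv2 s hs).trans (le_add_of_nonneg_left hX1))
        hg hqH hqH hκ hκa hκb (by positivity) ih
      rwa [div_div, ← pow_succ] at this
  have hzero : ∀ {x y D : ℝ}, (∀ k : ℕ, |x - y| ≤ ε / 2 ^ k * D) → x = y := by
    intro x y D hD
    have hlim : Tendsto (fun k : ℕ => ε / 2 ^ k * D) atTop (𝓝 0) := by
      have := (tendsto_pow_atTop_nhds_zero_of_lt_one (r := (1 / 2 : ℝ)) (by norm_num)
        (by norm_num)).const_mul (ε * D)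
      rw [mul_zero] at this
      refine this.congr fun k => ?_
      rw [one_div, inv_pow]
      ring
    exact sub_eq_zero.1 (abs_nonpos_iff.1 (ge_of_tendsto' hlim hD))
  have htt : t ∈ Icc 0 t := ⟨ht, le_rfl⟩
  exact ⟨funext fun n => hzero (D := Real.exp (κ * t) * g n) fun k =>
      ((hcl k t htt).1 n).trans_eq (mul_assoc _ _ _),
    hzero fun k => (hcl k t htt).2.1, hzero fun k => (hcl k t htt).2.2⟩

end DomSolution

/-! ### Solutions that are bounded in `ℓ¹(w)` are dominated -/

/-- A norm bound does not by itself give one dominating sequence. Dropping the loss, `|p t n|` is at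
most `|p 0 n|` plus a constant times the time integral of the gain of `|p|`. That integral is
nondecreasing in time, so its value at `T` serves all of `[0, T]`, and it is summable against `w`
because the gain operator is bounded. Nonnegativity of `p` is not needed. -/
theorem GainBound.locDom_of_step {a b w : ℤ → ℝ} {K c kl km : ℝ} {p : ℝ → ℤ → ℝ} {u v : ℝ → ℝ}
    (hG : GainBound a b w K) (hK : 0 ≤ K) (h : Step a b c kl km p u v p u v)
    (hu : ∀ t, 0 ≤ t → 0 < u t) (hv : ∀ t, 0 ≤ t → 0 < v t)
    (hmem : ∀ t, 0 ≤ t → Summable fun n => |p t n| * w n)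
    (hbd : ∀ T, ∃ R, ∀ t ∈ Icc 0 T, ∑' n, |p t n| * w n ≤ R) : LocDom w p := by
  have ha := hG.a_nonneg
  have hb := hG.b_nonneg
  have hpc : ∀ n, ContinuousOn (fun t => p t n) (Ici 0) := fun n t ht =>
    (h.eq_p t ht n).continuousWithinAt
  have huc : ContinuousOn (fun t => (u t)⁻¹) (Ici 0) :=
    ContinuousOn.inv₀ (fun t ht => (h.eq_u t ht).continuousWithinAt) fun s hs => (hu s hs).ne'
  have hvc : ContinuousOn (fun t => (v t)⁻¹) (Ici 0) :=
    ContinuousOn.inv₀ (fun t ht => (h.eq_v t ht).continuousWithinAt) fun s hs => (hv s hs).ne'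
  have hGc : ∀ n, ContinuousOn (fun t => gain a b (fun m => |p t m|) n) (Ici 0) := fun n =>
    ((hpc _).abs.const_mul _).add ((hpc _).abs.const_mul _)
  have hG0 : ∀ n t, 0 ≤ gain a b (fun m => |p t m|) n := fun n t =>
    gain_nonneg ha hb (fun m => abs_nonneg _) n
  choose Q hQ0 hQ using fun n => exists_primitive (hGc n)
  have hQmono : ∀ n, MonotoneOn (Q n) (Ici 0) := fun n =>
    monotoneOn_Ici_of_hasDerivWithinAt (hQ n) fun t _ => hG0 n t
  intro T
  rcases lt_or_ge T 0 with hT | hT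
  · exact ⟨fun _ => 0, fun _ => le_rfl, by simp [summable_zero],
      fun t ht => absurd (ht.1.trans ht.2) hT.not_ge⟩
  have hQnn : ∀ n, ∀ t, 0 ≤ t → 0 ≤ Q n t := fun n t ht =>
    (hQ0 n).symm.le.trans (hQmono n self_mem_Ici ht ht)
  obtain ⟨R, hR⟩ := hbd T
  obtain ⟨X, hX⟩ := isCompact_Icc.exists_bound_of_continuousOn
    (huc.mono (Icc_subset_Ici_self : Icc 0 T ⊆ Ici 0))
  obtain ⟨Y, hY⟩ := isCompact_Icc.exists_bound_of_continuousOn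
    (hvc.mono (Icc_subset_Ici_self : Icc 0 T ⊆ Ici 0))
  set Z := max X Y with hZ
  have hZ0 : 0 ≤ Z :=
    (norm_nonneg _).trans ((hX 0 ⟨le_rfl, hT⟩).trans (le_max_left _ _))
  have huZ : ∀ t ∈ Icc 0 T, (u t)⁻¹ ≤ Z := fun t ht =>
    (Real.le_norm_self _).trans ((hX t ht).trans (le_max_left _ _))
  have hvZ : ∀ t ∈ Icc 0 T, (v t)⁻¹ ≤ Z := fun t ht =>
    (Real.le_norm_self _).trans ((hY t ht).trans (le_max_right _ _))
  have hup : ∀ t, 0 ≤ t → 0 ≤ (u t)⁻¹ := fun t ht => (inv_pos.2 (hu t ht)).le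
  have hvp : ∀ t, 0 ≤ t → 0 ≤ (v t)⁻¹ := fun t ht => (inv_pos.2 (hv t ht)).le
  -- The gain has norm at most `2 K R` at each time, hence `2 K R T` after integration. Working with
  -- finite partial sums avoids interchanging sum and integral.
  have hQs : Summable fun n => Q n T * w n := by
    refine summable_of_sum_le (c := 2 * K * R * T)
      (fun n => mul_nonneg (hQnn n T hT) (hG.w_pos n).le) fun F => ?_
    have hnn := nonneg_of_linear (T := T) (r := fun _ => 0)
      (z := fun t => 2 * K * R * t - ∑ n ∈ F, Q n t * w n)
      (g := fun t => 2 * K * R - ∑ n ∈ F, gain a b (fun m => |p t m|) n * w n)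
      continuousOn_const (fun t ht => ?_) (fun t ht => ?_) (by simp [hQ0]) T ⟨hT, le_rfl⟩
    · linarith
    · refine ((((hasDerivAt_id t).const_mul (2 * K * R)).hasDerivWithinAt).sub
        (HasDerivWithinAt.fun_sum fun n _ => (hQ n t ht).mul_const (w n))).congr_deriv ?_
      simp
    · obtain ⟨hs, hle⟩ := hG.summable_gain (h := fun m => |p t m|) (fun m => abs_nonneg _)
        (hmem t ht.1)
      have h1 := hs.sum_le_tsum F fun n _ => mul_nonneg (hG0 n t) (hG.w_pos n).le
      have h2 := mul_le_mul_of_nonneg_left (hR t ht) (show 0 ≤ 2 * K by positivity)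
      linarith
  refine ⟨fun n => |p 0 n| + Z * Q n T, fun n => add_nonneg (abs_nonneg _)
    (mul_nonneg hZ0 (hQnn n T hT)), ?_, fun t ht n => ?_⟩
  · exact ((hmem 0 le_rfl).add (hQs.mul_left Z)).congr fun n => by ring
  · have hmain := abs_le_of_linear (T := T) (y := fun s => p s n)
      (E := fun s => |p 0 n| + Z * Q n s)
      (E' := fun s => Z * gain a b (fun m => |p s m|) n)
      ((huc.const_mul (a n)).add (hvc.const_mul (b n)))
      (fun s hs => add_nonneg (mul_nonneg (ha n) (hup s hs.1)) (mul_nonneg (hb n) (hvp s hs.1)))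
      (fun s hs => h.eq_p s hs n)
      (fun s hs => ((hQ n s hs).const_mul Z).const_add _)
      (fun s hs => add_nonneg (abs_nonneg _) (mul_nonneg hZ0 (hQnn n s hs.1)))
      (fun s hs => ?_) (by simp [hQ0]) t ht
    · have := mul_le_mul_of_nonneg_left (hQmono n ht.1 (mem_Ici.2 hT) ht.2) hZ0
      linarith
    · have key : ∀ {r y : ℝ} {m : ℤ}, 0 ≤ r → 0 ≤ y → y ≤ Z →
          |r * y * p s m| ≤ Z * (r * |p s m|) := by
        intro r y m hr hy hyX
        rw [abs_mul, abs_of_nonneg (mul_nonneg hr hy)]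
        have := mul_le_mul_of_nonneg_right hyX (mul_nonneg hr (abs_nonneg (p s m)))
        linarith
      refine (abs_add_le _ _).trans ?_
      unfold gain
      rw [mul_add]
      exact add_le_add (key (ha _) (hup s hs.1) (huZ s hs)) (key (hb _) (hvp s hs.1) (hvZ s hs))

/-! ### The Gaussian weights -/

theorem weight_pos (c α : ℝ) (n : ℤ) : 0 < weight c α n := Real.exp_pos _

/-- Completing the square: `(γ - δ) x ≤ c x² / 2 + (γ - δ)² / (2 c)`. -/
theorem exp_mul_abs_le_weight {c : ℝ} (hc : 0 < c) (γ δ : ℝ) (n : ℤ) :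
    Real.exp (γ * |(n : ℝ)|) ≤ Real.exp ((γ - δ) ^ 2 / (2 * c)) * weight c δ n := by
  rw [weight, ← Real.exp_add]
  refine Real.exp_le_exp.2 ?_
  have h : 0 ≤ (c * |(n : ℝ)| - (γ - δ)) ^ 2 / (2 * c) := by positivity
  have e : (c * |(n : ℝ)| - (γ - δ)) ^ 2 / (2 * c)
      = c * (n : ℝ) ^ 2 / 2 - (γ - δ) * |(n : ℝ)| + (γ - δ) ^ 2 / (2 * c) := by
    rw [← sq_abs (n : ℝ)]
    field_simp
    ring
  linarith

theorem mul_abs_sub_abs_le (γ x y : ℝ) (h : |x - y| ≤ 1) : γ * |x| ≤ γ * |y| + |γ| := by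
  have h1 : |γ * (|x| - |y|)| ≤ |γ| * 1 := by
    rw [abs_mul]
    exact mul_le_mul_of_nonneg_left ((abs_abs_sub_abs_le x y).trans h) (abs_nonneg _)
  linarith [le_abs_self (γ * (|x| - |y|))]

/-- Since `(n ± 1)² / 2 = n² / 2 ± n + 1 / 2`, the growth of the Gaussian under a jump cancels the
factor `exp (∓ c n)` of its rate, leaving `exp (c / 2)`. The factor `exp (γ |n|)` changes by at most
`exp |γ|`. -/
theorem gainBound_weight {β : ℤ → ℝ} {c B : ℝ} (hβ : ∀ n, 0 < β n) (hB : ∀ n, β n ≤ B)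
    (γ : ℝ) {K : ℝ} (hK : B * Real.exp (c / 2 + |γ|) ≤ K) :
    GainBound (fun n => β n * Real.exp (-c * n)) (fun n => β (n - 1) * Real.exp (c * n))
      (weight c γ) K where
  a_nonneg n := (mul_pos (hβ n) (Real.exp_pos _)).le
  b_nonneg n := (mul_pos (hβ _) (Real.exp_pos _)).le
  w_pos := weight_pos c γ
  up n := by
    have h1 : Real.exp (-c * n) * weight c γ (n + 1)
        ≤ Real.exp (c / 2 + |γ|) * weight c γ n := by
      rw [weight, weight, ← Real.exp_add, ← Real.exp_add]
      refine Real.exp_le_exp.2 ?_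
      have := mul_abs_sub_abs_le γ ((n + 1 : ℤ) : ℝ) n (by simp)
      push_cast at this ⊢
      linarith
    have h2 := mul_le_mul (hB n) h1 (mul_pos (Real.exp_pos _) (weight_pos _ _ _)).le
      ((hβ n).le.trans (hB n))
    have h3 := mul_le_mul_of_nonneg_right hK (weight_pos c γ n).le
    linarith
  down n := by
    have h1 : Real.exp (c * n) * weight c γ (n - 1)
        ≤ Real.exp (c / 2 + |γ|) * weight c γ n := by
      rw [weight, weight, ← Real.exp_add, ← Real.exp_add]
      refine Real.exp_le_exp.2 ?_
      have := mul_abs_sub_abs_le γ ((n - 1 : ℤ) : ℝ) n (by simp)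
      push_cast at this ⊢
      linarith
    have h2 := mul_le_mul (hB (n - 1)) h1 (mul_pos (Real.exp_pos _) (weight_pos _ _ _)).le
      ((hβ n).le.trans (hB n))
    have h3 := mul_le_mul_of_nonneg_right hK (weight_pos c γ n).le
    linarith

/-- The rates are at most `B exp (c |n|)`, and lowering `α` by `c` gives `exp (c |n|) w' = w`, which
pays for the loss. -/
theorem exists_admissible_weight {β : ℤ → ℝ} (hβ : ∀ n, 0 < β n) (hβ_bdd : BddAbove (range β))
    {c : ℝ} (hc : 0 < c) (α : ℝ) :
    ∃ K, Admissible (fun n => β n * Real.exp (-c * n)) (fun n => β (n - 1) * Real.exp (c * n))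
      (weight c α) (weight c (α - c)) K := by
  obtain ⟨B, hB'⟩ := hβ_bdd
  have hB : ∀ n, β n ≤ B := fun n => hB' (mem_range_self n)
  have hB0 : 0 < B := (hβ 0).trans_le (hB 0)
  have hrate : ∀ m n : ℤ, ∀ x : ℝ, x ≤ |(n : ℝ)| →
      β m * Real.exp (c * x) ≤ B * Real.exp (c * |(n : ℝ)|) := fun m n x hx =>
    mul_le_mul (hB m) (Real.exp_le_exp.2 (mul_le_mul_of_nonneg_left hx hc.le))
      (Real.exp_pos _).le hB0.le
  have ha : ∀ n : ℤ, β n * Real.exp (-c * n) ≤ B * Real.exp (c * |(n : ℝ)|) := fun n => by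
    have := hrate n n (-n) (neg_le_abs _)
    rwa [mul_neg, ← neg_mul] at this
  have hb : ∀ n : ℤ, β (n - 1) * Real.exp (c * n) ≤ B * Real.exp (c * |(n : ℝ)|) := fun n =>
    hrate (n - 1) n n (le_abs_self _)
  have hww : ∀ n : ℤ, Real.exp (c * |(n : ℝ)|) * weight c (α - c) n = weight c α n := fun n => by
    rw [weight, weight, ← Real.exp_add]
    congr 1
    ring
  set K₁ := B * Real.exp (c / 2 + |α|) with hK₁
  set K₂ := B * Real.exp (c / 2 + |α - c|) with hK₂
  set K₃ := B * Real.exp ((c - (α - c)) ^ 2 / (2 * c)) with hK₃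
  set K₄ := Real.exp ((0 - (α - c)) ^ 2 / (2 * c)) with hK₄
  have p1 : 0 < K₁ := by positivity
  have p2 : 0 < K₂ := by positivity
  have p3 : 0 < K₃ := by positivity
  have p4 : 0 < K₄ := by positivity
  have hf : ∀ n : ℤ, B * Real.exp (c * |(n : ℝ)|)
      ≤ (K₁ + K₂ + K₃ + K₄ + 2 * B + 1) * weight c (α - c) n := fun n => by
    have h1 := mul_le_mul_of_nonneg_left (exp_mul_abs_le_weight hc c (α - c) n) hB0.le
    rw [← mul_assoc, ← hK₃] at h1
    exact h1.trans (mul_le_mul_of_nonneg_right (by linarith) (weight_pos _ _ _).le)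
  -- One summand per requirement: `K₁`, `K₂` for the gain in the two weights, `K₃` for the rates,
  -- `K₄` for constants, `2 * B` for the loss, `1` for `w' ≤ w`.
  refine ⟨K₁ + K₂ + K₃ + K₄ + 2 * B + 1, gainBound_weight hβ hB α (by linarith),
    gainBound_weight hβ hB (α - c) (by linarith), fun n => ?_, fun n => ?_,
    fun n => (ha n).trans (hf n), fun n => (hb n).trans (hf n), fun n => ?_⟩
  · have h1 : weight c (α - c) n ≤ weight c α n := by
      rw [← hww n]
      exact le_mul_of_one_le_left (weight_pos _ _ _).le (Real.one_le_exp (by positivity))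
    exact h1.trans (le_mul_of_one_le_left (weight_pos _ _ _).le (by linarith))
  · have h1 := mul_le_mul_of_nonneg_right (add_le_add (ha n) (hb n))
      (weight_pos c (α - c) n).le
    have h2 := mul_le_mul_of_nonneg_right
      (show 2 * B ≤ K₁ + K₂ + K₃ + K₄ + 2 * B + 1 by linarith) (weight_pos c α n).le
    rw [← hww n] at h2 ⊢
    linarith
  · have h1 := exp_mul_abs_le_weight hc 0 (α - c) n
    rw [zero_mul, Real.exp_zero, ← hK₄] at h1
    exact h1.trans (mul_le_mul_of_nonneg_right (by linarith) (weight_pos _ _ _).le)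

/-! ### The variables `u = exp (-c L)` and `v = exp (c M)` -/

theorem rateUp_eq (β : ℤ → ℝ) (c L : ℝ) (n : ℤ) :
    rateUp β c L n = β n * Real.exp (-c * n) * (Real.exp (-c * L))⁻¹ := by
  rw [rateUp, ← Real.exp_neg, mul_assoc, ← Real.exp_add]
  ring_nf

theorem rateDown_eq (β : ℤ → ℝ) (c M : ℝ) (n : ℤ) :
    rateDown β c M n = β (n - 1) * Real.exp (c * n) * (Real.exp (c * M))⁻¹ := by
  rw [rateDown, ← Real.exp_neg, mul_assoc, ← Real.exp_add]
  ring_nf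

theorem tsum_rateUp (β : ℤ → ℝ) (c L : ℝ) (p : ℤ → ℝ) :
    ∑' n, p n * rateUp β c L n
      = (∑' n, p n * (β n * Real.exp (-c * n))) * (Real.exp (-c * L))⁻¹ := by
  rw [← tsum_mul_right]
  exact tsum_congr fun n => by rw [rateUp_eq]; ring

theorem tsum_rateDown (β : ℤ → ℝ) (c M : ℝ) (p : ℤ → ℝ) :
    ∑' n, p n * rateDown β c M n
      = (∑' n, p n * (β (n - 1) * Real.exp (c * n))) * (Real.exp (c * M))⁻¹ := by
  rw [← tsum_mul_right]
  exact tsum_congr fun n => by rw [rateDown_eq]; ring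

/-- In `u' = -c L' u` the factor `exp (c L)` of the upward rates cancels `u`, so the equation
becomes linear; likewise for `v`. -/
theorem SystemLM.step {β : ℤ → ℝ} {c Cl Cm : ℝ} {p : ℝ → ℤ → ℝ} {L M : ℝ → ℝ}
    (h : SystemLM β c Cl Cm p L M) :
    Step (fun n => β n * Real.exp (-c * n)) (fun n => β (n - 1) * Real.exp (c * n)) c
      (c * Cl) (c * Cm) p (fun t => Real.exp (-c * L t)) (fun t => Real.exp (c * M t))
      p (fun t => Real.exp (-c * L t)) (fun t => Real.exp (c * M t)) where
  eq_p t ht n := (h.eq_p t ht n).congr_deriv (by simp only [rateUp_eq, rateDown_eq]; ring)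
  eq_u t ht := by
    refine (((h.eq_L t ht).const_mul (-c)).exp).congr_deriv ?_
    rw [tsum_rateUp]
    have := (Real.exp_pos (-c * L t)).ne'
    field_simp
    ring
  eq_v t ht := by
    refine (((h.eq_M t ht).const_mul c).exp).congr_deriv ?_
    rw [tsum_rateDown]
    have := (Real.exp_pos (c * M t)).ne'
    field_simp
    ring

theorem DomSolution.systemLM {β w : ℤ → ℝ} {c Cl Cm : ℝ} {p : ℝ → ℤ → ℝ} {u v : ℝ → ℝ}
    (hc : 0 < c) (h : DomSolution (fun n => β n * Real.exp (-c * n))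
      (fun n => β (n - 1) * Real.exp (c * n)) w c (c * Cl) (c * Cm) p u v) :
    SystemLM β c Cl Cm p (fun t => -Real.log (u t) / c) (fun t => Real.log (v t) / c) := by
  have hu : ∀ t, 0 ≤ t → Real.exp (-c * (-Real.log (u t) / c)) = u t := fun t ht => by
    rw [show -c * (-Real.log (u t) / c) = Real.log (u t) by field_simp, Real.exp_log (h.u_pos t ht)]
  have hv : ∀ t, 0 ≤ t → Real.exp (c * (Real.log (v t) / c)) = v t := fun t ht => by
    rw [show c * (Real.log (v t) / c) = Real.log (v t) by field_simp, Real.exp_log (h.v_pos t ht)]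
  refine ⟨fun t ht n => (h.step.eq_p t ht n).congr_deriv ?_, fun t ht => ?_, fun t ht => ?_⟩
  · simp only [rateUp_eq, rateDown_eq, hu t ht, hv t ht]
    ring
  · have hne := (h.u_pos t ht).ne'
    refine (((h.step.eq_u t ht).log hne).fun_neg.div_const c).congr_deriv ?_
    rw [tsum_rateUp, hu t ht]
    field_simp
    ring
  · have hne := (h.v_pos t ht).ne'
    refine (((h.step.eq_v t ht).log hne).div_const c).congr_deriv ?_
    rw [tsum_rateDown, hv t ht]
    field_simp
    ring

/-! ### The solution class -/

/-- Dominated convergence: coordinatewise continuity and a common majorant in `ℓ¹(w)` give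
continuity in norm. -/
theorem tendsto_normB_sub {c α : ℝ} {p : ℝ → ℤ → ℝ} (hd : LocDom (weight c α) p)
    (hp : ∀ n, ContinuousOn (fun t => p t n) (Ici 0)) {t : ℝ} (ht : 0 ≤ t) :
    Tendsto (fun u => normB c α (p u - p t)) (𝓝[Ici 0] t) (𝓝 0) := by
  have hd' : LocDom (weight c α) fun s n => |p s n - p t n| := by
    intro T
    obtain ⟨H, h0, hs, hH⟩ := hd T
    obtain ⟨H', h0', hs', hH'⟩ := hd t
    refine ⟨fun n => H n + H' n, fun n => add_nonneg (h0 n) (h0' n),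
      (hs.add hs').congr fun n => by ring, fun s hs n => ?_⟩
    rw [abs_abs]
    exact (abs_sub _ _).trans (add_le_add (hH s hs n) (hH' t ⟨ht, le_rfl⟩ n))
  have hc := hd'.continuousOn_tsum (φ := weight c α) (K := 1)
    (fun n => ((hp n).sub continuousOn_const).abs)
    (fun n => by rw [one_mul, abs_of_pos (weight_pos c α n)]) t ht
  have h0 : ∑' n, |p t n - p t n| * weight c α n = 0 := by simp
  have := hc.tendsto
  rw [h0] at this
  exact this

theorem InClass.exists_norm_le {c α : ℝ} {p : ℝ → ℤ → ℝ} {L M : ℝ → ℝ}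
    (h : InClass c α p L M) (T : ℝ) :
    ∃ R, ∀ t ∈ Icc 0 T, ∑' n, |p t n| * weight c α n ≤ R := by
  have habs : ∀ s t, 0 ≤ s → 0 ≤ t →
      |normB c α (p s) - normB c α (p t)| ≤ normB c α (p s - p t) := by
    intro s t hs ht
    have hbd : ∀ n, |(|p s n| * weight c α n - |p t n| * weight c α n)|
        ≤ |(p s - p t) n| * weight c α n := fun n => by
      rw [← sub_mul, abs_mul, abs_of_pos (weight_pos c α n)]
      exact mul_le_mul_of_nonneg_right (abs_abs_sub_abs_le _ _) (weight_pos c α n).le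
    have hsum : Summable fun n => |(p s - p t) n| * weight c α n := by
      refine Summable.of_nonneg_of_le
        (fun n => mul_nonneg (abs_nonneg _) (weight_pos c α n).le) (fun n => ?_)
        ((h.mem s hs).add (h.mem t ht))
      rw [← add_mul]
      exact mul_le_mul_of_nonneg_right (abs_sub _ _) (weight_pos c α n).le
    rw [normB, normB, ← (h.mem s hs).tsum_sub (h.mem t ht)]
    exact tsum_of_norm_bounded (f := fun n => |p s n| * weight c α n - |p t n| * weight c α n)
      hsum.hasSum hbd
  have hcont : ContinuousOn (fun t => normB c α (p t)) (Icc 0 T) := by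
    intro t ht
    refine ContinuousWithinAt.mono ?_ (Icc_subset_Ici_self : Icc 0 T ⊆ Ici 0)
    rw [ContinuousWithinAt, tendsto_iff_norm_sub_tendsto_zero]
    refine squeeze_zero' (Eventually.of_forall fun s => norm_nonneg _) ?_ (h.cont t ht.1)
    filter_upwards [self_mem_nhdsWithin] with s hs
    exact habs s t hs ht.1
  obtain ⟨R, hR⟩ := isCompact_Icc.exists_bound_of_continuousOn hcont
  exact ⟨R, fun t ht => (Real.le_norm_self _).trans (hR t ht)⟩

theorem uniqueGlobalSolution_systemLM {β : ℤ → ℝ} (hβ_pos : ∀ n, 0 < β n)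
    (hβ_bdd : BddAbove (range β)) {c : ℝ} (hc : 0 < c) (α : ℝ) {Cl Cm : ℝ} (hCl : 0 ≤ Cl)
    (hCm : 0 ≤ Cm) {p₀ : ℤ → ℝ} (hp₀ : IsProb p₀) (hp₀_mem : MemB c α p₀) (L₀ M₀ : ℝ) :
    UniqueGlobalSolution c α (fun p L M => SystemLM β c Cl Cm p L M) p₀ L₀ M₀ := by
  obtain ⟨K, hA⟩ := exists_admissible_weight hβ_pos hβ_bdd hc α
  have hkl : 0 ≤ c * Cl := mul_nonneg hc.le hCl
  have hkm : 0 ≤ c * Cm := mul_nonneg hc.le hCm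
  obtain ⟨h, hph, hhw, hhg⟩ := hA.strong.exists_majorant hp₀.1
    (hp₀_mem.congr fun n => by rw [abs_of_nonneg (hp₀.1 n)])
  have hh : ∀ n, 0 ≤ h n := fun n => (hp₀.1 n).trans (hph n)
  have hu₀ := Real.exp_pos (-c * L₀)
  have hv₀ := Real.exp_pos (c * M₀)
  obtain ⟨p, u, v, hI, hS⟩ := exists_iterate_fixed hA hc.le hkl hkm hu₀ hv₀ hp₀.1 hph hhw hhg
  have hD : DomSolution (fun n => β n * Real.exp (-c * n))
      (fun n => β (n - 1) * Real.exp (c * n)) (weight c α) c (c * Cl) (c * Cm) p u v :=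
    ⟨hS, hI.locDom hu₀ hv₀ hA.K_pos.le hh hhw, hI.u_pos hu₀, hI.v_pos hv₀⟩
  refine ⟨p, fun t => -Real.log (u t) / c, fun t => Real.log (v t) / c,
    ⟨⟨fun t ht => ?_, fun t ht => tendsto_normB_sub hD.dom hD.cont_p ht, ?_, ?_⟩,
      hD.systemLM hc, hI.init_p, ?_, ?_⟩, fun t ht => ⟨hI.p_nonneg t ht, ?_⟩, ?_⟩
  · have := hD.dom.summable (φ := weight c α) (K := 1)
      (fun n => by rw [one_mul, abs_of_pos (weight_pos c α n)]) ht
    exact this.congr fun n => by rw [abs_of_nonneg (hI.p_nonneg t ht n)]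
  · exact ((hD.contDiffOn_u hA).log fun t ht => (hD.u_pos t ht).ne').neg.div_const c
  · exact ((hD.contDiffOn_v hA).log fun t ht => (hD.v_pos t ht).ne').div_const c
  · simp only [hI.init_u, Real.log_exp]
    field_simp
  · simp only [hI.init_v, Real.log_exp]
    field_simp
  · exact hD.hasSum_eq hA ht (hI.init_p ▸ hp₀.2)
  · intro q L M hq hsys hq0 hL0 hM0 t ht
    -- The competitor is not assumed nonnegative; its norm continuity supplies the domination that
    -- uniqueness needs.
    have hstep := hsys.step
    have hD' : DomSolution (fun n => β n * Real.exp (-c * n))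
        (fun n => β (n - 1) * Real.exp (c * n)) (weight c α) c (c * Cl) (c * Cm) q
        (fun t => Real.exp (-c * L t)) (fun t => Real.exp (c * M t)) :=
      ⟨hstep, hA.strong.locDom_of_step hA.K_pos.le hstep (fun _ _ => Real.exp_pos _)
        (fun _ _ => Real.exp_pos _) hq.mem hq.exists_norm_le,
        fun _ _ => Real.exp_pos _, fun _ _ => Real.exp_pos _⟩
    obtain ⟨h1, h2, h3⟩ := hD'.unique hA hc.le hkl hkm hD (hq0.trans hI.init_p.symm)
      (by rw [hL0, hI.init_u]) (by rw [hM0, hI.init_v]) ht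
    refine ⟨h1, ?_, ?_⟩
    · simp only [← h2, Real.log_exp]
      field_simp
    · simp only [← h3, Real.log_exp]
      field_simp

/-! ### The symmetric variables -/

theorem exp_mul_rateUp (β : ℤ → ℝ) (c L M : ℝ) (n : ℤ) :
    Real.exp (c * ((L - M) / 2)) * (β n * Real.exp (c * (-(n : ℝ) + (L + M) / 2)))
      = rateUp β c L n := by
  rw [rateUp, mul_left_comm, ← Real.exp_add]
  ring_nf

theorem exp_mul_rateDown (β : ℤ → ℝ) (c L M : ℝ) (n : ℤ) :
    Real.exp (c * ((L - M) / 2)) * (β (n - 1) * Real.exp (c * ((n : ℝ) - (L + M) / 2)))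
      = rateDown β c M n := by
  rw [rateDown, mul_left_comm, ← Real.exp_add]
  ring_nf

theorem exp_mul_tsum_rateUp (β : ℤ → ℝ) (c L M : ℝ) (p : ℤ → ℝ) :
    Real.exp (c * ((L - M) / 2)) * ∑' n : ℤ, p n * β n * Real.exp (c * (-(n : ℝ) + (L + M) / 2))
      = ∑' n, p n * rateUp β c L n := by
  rw [← tsum_mul_left]
  exact tsum_congr fun n => by rw [← exp_mul_rateUp β c L M n]; ring

theorem exp_mul_tsum_rateDown (β : ℤ → ℝ) (c L M : ℝ) (p : ℤ → ℝ) :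
    Real.exp (c * ((L - M) / 2)) *
        ∑' n : ℤ, p n * β (n - 1) * Real.exp (c * ((n : ℝ) - (L + M) / 2))
      = ∑' n, p n * rateDown β c M n := by
  rw [← tsum_mul_left]
  exact tsum_congr fun n => by rw [← exp_mul_rateDown β c L M n]; ring

/-- With `L = s + d` and `M = s - d`, the common factor `exp (c d)` turns `exp (c s)` into `exp (c
L)` and `exp (-c s)` into `exp (-c M)`. -/
theorem systemSD_iff (β : ℤ → ℝ) (c C : ℝ) (p : ℝ → ℤ → ℝ) (L M : ℝ → ℝ) :
    SystemSD β c C p (fun t => (L t + M t) / 2) (fun t => (L t - M t) / 2) ↔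
      SystemLM β c C C p L M := by
  have hp : ∀ t n,
      Real.exp (c * ((L t - M t) / 2)) *
        (β (n - 1) * Real.exp (c * (-(n : ℝ) + 1 + (L t + M t) / 2)) * p t (n - 1)
          - (β n * Real.exp (c * (-(n : ℝ) + (L t + M t) / 2))
              + β (n - 1) * Real.exp (c * ((n : ℝ) - (L t + M t) / 2))) * p t n
          + β n * Real.exp (c * ((n : ℝ) + 1 - (L t + M t) / 2)) * p t (n + 1))
      = rateUp β c (L t) (n - 1) * p t (n - 1)
        - (rateUp β c (L t) n + rateDown β c (M t) n) * p t n
        + rateDown β c (M t) (n + 1) * p t (n + 1) := by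
    intro t n
    -- At `n + 1` the downward rate carries `β (n + 1 - 1)`, which is the `β n` of the symmetric
    -- system.
    rw [← exp_mul_rateUp β c (L t) (M t) n, ← exp_mul_rateUp β c (L t) (M t) (n - 1),
      ← exp_mul_rateDown β c (L t) (M t) n, ← exp_mul_rateDown β c (L t) (M t) (n + 1),
      add_sub_cancel_right]
    push_cast
    rw [neg_sub', sub_neg_eq_add]
    ring
  have hL : ∀ t, Real.exp (c * ((L t - M t) / 2)) *
      ∑' n : ℤ, p t n * β n * Real.exp (c * (-(n : ℝ) + (L t + M t) / 2))
      = ∑' n, p t n * rateUp β c (L t) n := fun t => exp_mul_tsum_rateUp β c (L t) (M t) (p t)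
  have hM : ∀ t, Real.exp (c * ((L t - M t) / 2)) *
      ∑' n : ℤ, p t n * β (n - 1) * Real.exp (c * ((n : ℝ) - (L t + M t) / 2))
      = ∑' n, p t n * rateDown β c (M t) n := fun t =>
    exp_mul_tsum_rateDown β c (L t) (M t) (p t)
  constructor
  · intro h
    refine ⟨fun t ht n => (h.eq_p t ht n).congr_deriv (hp t n), fun t ht => ?_, fun t ht => ?_⟩
    · have h1 := (h.eq_s t ht).fun_add (h.eq_d t ht)
      have e : (fun s => (L s + M s) / 2 + (L s - M s) / 2) = L := by funext s; ring
      rw [e] at h1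
      exact h1.congr_deriv (by rw [← hL t]; ring)
    · have h1 := (h.eq_s t ht).fun_sub (h.eq_d t ht)
      have e : (fun s => (L s + M s) / 2 - (L s - M s) / 2) = M := by funext s; ring
      rw [e] at h1
      exact h1.congr_deriv (by rw [← hM t]; ring)
  · intro h
    refine ⟨fun t ht n => (h.eq_p t ht n).congr_deriv (hp t n).symm, fun t ht => ?_,
      fun t ht => ?_⟩
    · refine (((h.eq_L t ht).fun_add (h.eq_M t ht)).div_const 2).congr_deriv ?_
      rw [← hL t, ← hM t]
      ring
    · refine (((h.eq_L t ht).fun_sub (h.eq_M t ht)).div_const 2).congr_deriv ?_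
      rw [← hL t, ← hM t]
      ring

end NonlinearWalk
theorem theorem1 (β : ℤ → ℝ) (hβ_pos : ∀ n, 0 < β n) (hβ_bdd : BddAbove (Set.range β))
    (c : ℝ) (hc : 0 < c) (α : ℝ) (Cl Cm : ℝ) (hCl : 0 < Cl) (hCm : 0 < Cm)
    (p₀ : ℤ → ℝ) (hp₀_prob : NonlinearWalk.IsProb p₀) (hp₀_mem : NonlinearWalk.MemB c α p₀)
    (L₀ M₀ : ℝ) :
    NonlinearWalk.UniqueGlobalSolution c α
        (fun p L M => NonlinearWalk.SystemLM β c Cl Cm p L M) p₀ L₀ M₀ ∧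
      (Cl = Cm →
        NonlinearWalk.UniqueGlobalSolution c α
          (fun p L M => NonlinearWalk.SystemSD β c Cl p
            (fun t => (L t + M t) / 2) (fun t => (L t - M t) / 2)) p₀ L₀ M₀) := by
  refine ⟨NonlinearWalk.uniqueGlobalSolution_systemLM hβ_pos hβ_bdd hc α hCl.le hCm.le hp₀_prob
    hp₀_mem L₀ M₀, fun _ => ?_⟩
  -- The symmetric system contains only `Cl`, so this is the first claim with both constants equal
  -- to `Cl`.
  simp only [NonlinearWalk.systemSD_iff]
  exact NonlinearWalk.uniqueGlobalSolution_systemLM hβ_pos hβ_bdd hc α hCl.le hCl.le hp₀_prob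
    hp₀_mem L₀ M₀
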